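/- Let $L$ be a compact connected smooth manifold (without boundary), let $\varphi\in\mathrm{Diff}(L)$, and let $$\mathbb{T}_\varphi=\frac{L\times\mathbb{R}}{(x,t)\sim(\varphi(x),t+1)}$$ be its mapping torus, with projection $\mathbb{T}_\varphi\to S^1=\mathbb{R}/\mathbb{Z}$, $[x,t]\mapsto t$. Let $\alpha\in\Omega^1(L)$ be a closed nowhere-vanishing one-form with $\varphi^*\alpha=e^{\lambda}\alpha$ for some real $\lambda\neq 0$. Let $\omega_1,\omega_2\in\Omega^1(\mathbb{T}_\varphi)$ be the one-forms $$\omega_1=e^{-\lambda t}\alpha,\qquad \omega_2=-\lambda\,dt,$$ that is, the one-forms whose pullbacks to $L\times\mathbb{R}$ are given by these formulas, and let $\mathcal{G}_{\alpha,\lambda}$ be the foliation of $\mathbb{T}_\varphi$ with $T\mathcal{G}_{\alpha,\lambda}=\ker\omega_1\cap\ker\omega_2$. Let $\zeta_1,\zeta_2\in\Omega^1(\mathbb{T}_\varphi)$ be one-forms that are linearly independent at every point and satisfy $T\mathcal{G}_{\alpha,\lambda}=\ker\zeta_1\cap\ker\zeta_2$ and $$d\zeta_1-\zeta_2\wedge\zeta_1=0,\qquad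 d\zeta_2=0.$$ Then there exist $f,g\in C^\infty(S^1)$ and a real number $K\neq 0$ such that $$\zeta_2=\omega_2+df,\qquad \zeta_1=e^{f}\left(K\omega_1+dg-g\,\omega_2\right),$$ where $f$ and $g$ are regarded as functions on $\mathbb{T}_\varphi$ via the projection $\mathbb{T}_\varphi\to S^1$. -/

import Mathlib

open scoped Manifold ContDiff Topology
open Set

noncomputable section

section OneForms

variable {V H M : Type*} [NormedAddCommGroup V] [NormedSpace ℝ V] [TopologicalSpace H]
  [TopologicalSpace M] [ChartedSpace H M]

/-- A (not necessarily smooth) one-form on `M`: a covector at every point. -/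
abbrev OneForm (I : ModelWithCorners ℝ V H) (M : Type*) [TopologicalSpace M]
    [ChartedSpace H M] : Type _ :=
  (p : M) → (TangentSpace I p →L[ℝ] ℝ)

variable (I : ModelWithCorners ℝ V H)

/-- `β ∈ Ω¹(M)`: the one-form `β` is a smooth section of the cotangent bundle. -/
def OneForm.IsSmooth [IsManifold I ∞ M] (β : OneForm I M) : Prop :=
  ContMDiff I (I.prod 𝓘(ℝ, V →L[ℝ] ℝ)) ∞
    (fun p => Bundle.TotalSpace.mk' (V →L[ℝ] ℝ)
      (E := fun p : M => TangentSpace I p →L[ℝ] ℝ) p (β p))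

/-- The differential `df` of a real function. -/
def OneForm.differential (f : M → ℝ) : OneForm I M :=
  fun p => mfderiv I 𝓘(ℝ, ℝ) f p

variable {I}

/-- The coordinate expression of `β` in the preferred chart around `p`, i.e. its pullback under the
inverse of that chart, as a covector-valued map on the model vector space. -/
def OneForm.inChart (β : OneForm I M) (p : M) (y : V) : V →L[ℝ] ℝ :=
  (β ((extChartAt I p).symm y)).comp
    (mfderivWithin 𝓘(ℝ, V) I (extChartAt I p).symm (range I) y)

/-- The exterior derivative `dβ`, evaluated at `p` on the tangent vectors `u, v`: the exterior
derivative of the coordinate expression of `β` in the preferred chart around `p` (in which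
`T_p M` is identified with the model vector space). -/
def OneForm.extDeriv (β : OneForm I M) (p : M) (u v : TangentSpace I p) : ℝ :=
  extDerivWithin
    (fun y => ContinuousAlternatingMap.ofSubsingleton ℝ V ℝ (0 : Fin 1) (β.inChart p y))
    (range I) (extChartAt I p p) ![(u : V), (v : V)]

/-- The wedge product `β ∧ γ`, evaluated at `p` on the tangent vectors `u, v`. -/
def OneForm.wedge (β γ : OneForm I M) (p : M) (u v : TangentSpace I p) : ℝ :=
  β p u * γ p v - β p v * γ p u

/-- The pullback `F^* β` of a one-form. -/
def OneForm.pullback {V' H' N : Type*} [NormedAddCommGroup V'] [NormedSpace ℝ V']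
    [TopologicalSpace H'] [TopologicalSpace N] [ChartedSpace H' N]
    {J : ModelWithCorners ℝ V' H'} (F : N → M) (β : OneForm I M) : OneForm J N :=
  fun q => (β (F q)).comp (mfderiv J I F q)

theorem OneForm.pullback_id (β : OneForm I M) : OneForm.pullback (J := I) id β = β := by
  funext p
  rw [OneForm.pullback, mfderiv_id]
  exact ContinuousLinearMap.comp_id _

theorem OneForm.pullback_pullback {V' H' N V'' H'' P : Type*}
    [NormedAddCommGroup V'] [NormedSpace ℝ V'] [TopologicalSpace H'] [TopologicalSpace N]
    [ChartedSpace H' N] {J : ModelWithCorners ℝ V' H'}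
    [NormedAddCommGroup V''] [NormedSpace ℝ V''] [TopologicalSpace H''] [TopologicalSpace P]
    [ChartedSpace H'' P] {J' : ModelWithCorners ℝ V'' H''}
    (F : N → M) (G : P → N) (β : OneForm I M)
    (hF : MDifferentiable J I F) (hG : MDifferentiable J' J G) :
    OneForm.pullback (J := J') G (OneForm.pullback (J := J) F β) =
      OneForm.pullback (J := J') (F ∘ G) β := by
  funext p
  change _ = (β (F (G p))).comp (mfderiv J' I (F ∘ G) p)
  rw [mfderiv_comp p (hF _) (hG _)]
  rfl

end OneForms

section Quotients

variable {V H M N : Type*} [NormedAddCommGroup V] [NormedSpace ℝ V] [TopologicalSpace H]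
  [TopologicalSpace M] [ChartedSpace H M] [TopologicalSpace N]

/-- The charts pushed forward along a surjective local homeomorphism `π : M → N` form a smooth
atlas, if any two points in the same fibre of `π` are related by a smooth map over `N`. -/
theorem isManifold_of_localHomeomorph (I : ModelWithCorners ℝ V H) [IsManifold I ∞ M]
    {π : M → N} (hπ : IsLocalHomeomorph π) {σ : N → M} (hσ : Function.RightInverse σ π)
    (h : ∀ a b : M, π a = π b → ∃ T : M → M, ContMDiff I I ∞ T ∧ T a = b ∧ ∀ x, π (T x) = π x) :
    letI : ChartedSpace H N := hπ.chartedSpaceOfRightInverse hσ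
    IsManifold I ∞ N := by
  let _ : ChartedSpace H N := hπ.chartedSpaceOfRightInverse hσ
  apply isManifold_of_contDiffOn
  rintro _ _ ⟨p, rfl⟩ ⟨q, rfl⟩
  set s := hπ.localInverseAt (σ p) with hs
  set s' := hπ.localInverseAt (σ q) with hs'
  set c := chartAt H (σ p)
  set c' := chartAt H (σ q)
  have hsymm : ∀ x, s.symm x = π x := fun x => by rw [hs, hπ.localInverseAt_symm]
  have hsymm' : ∀ x, s'.symm x = π x := fun x => by rw [hs', hπ.localInverseAt_symm]
  rintro y ⟨hy, hyr⟩
  simp only [OpenPartialHomeomorph.trans_source, OpenPartialHomeomorph.symm_source,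
    OpenPartialHomeomorph.trans_symm_eq_symm_trans_symm,
    mem_preimage, mem_inter_iff, OpenPartialHomeomorph.coe_trans, Function.comp_apply] at hy
  obtain ⟨⟨hy1, hy2⟩, hy3, hy4⟩ := hy
  set z := I.symm y with hz
  set u := c.symm z with hu
  rw [hsymm] at hy3 hy4
  set u' := s' (π u) with hu'
  have hπu' : π u' = π u := by
    rw [← hsymm', hu']; exact s'.left_inv hy3
  obtain ⟨T, hT, hTu, hTπ⟩ := h u u' hπu'.symm
  have hu't : u' ∈ s'.target := s'.map_source hy3
  -- the transition map agrees with `c' ∘ T ∘ c.symm` near `z`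
  have hev : ∀ᶠ x in 𝓝 u, s' (π x) = T x := by
    have : ∀ᶠ x in 𝓝 u, T x ∈ s'.target :=
      hT.continuous.continuousAt.eventually (by rw [hTu]; exact s'.open_target.mem_nhds hu't)
    filter_upwards [this] with x hx
    rw [← hTπ x, ← hsymm', s'.right_inv hx]
  have hcz : ContMDiffAt I I ∞ c.symm z :=
    (contMDiffOn_chart_symm (I := I) (n := ∞) (x := σ p)).contMDiffAt (c.open_target.mem_nhds hy1)
  have hc' : ContMDiffAt I I ∞ c' (T u) :=
    (contMDiffOn_chart (I := I) (n := ∞) (x := σ q)).contMDiffAt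
      (c'.open_source.mem_nhds (by rw [hTu]; exact hy4))
  have hcomp : ContMDiffAt I I ∞ (c' ∘ T ∘ c.symm) z :=
    ContMDiffAt.comp z hc' (ContMDiffAt.comp z hT.contMDiffAt hcz)
  have hev2 : ∀ᶠ w in 𝓝 z, (c' ∘ s' ∘ π ∘ c.symm) w = (c' ∘ T ∘ c.symm) w := by
    filter_upwards [(c.continuousAt_symm hy1).eventually hev] with w hw
    simp only [Function.comp_apply]
    rw [hw]
  have hfin : ContMDiffAt I I ∞ (c' ∘ s' ∘ π ∘ c.symm) z := hcomp.congr_of_eventuallyEq hev2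
  rw [contMDiffAt_iff] at hfin
  have h2 : ContDiffWithinAt ℝ ∞ (I ∘ (c' ∘ s' ∘ π ∘ c.symm) ∘ I.symm) (range I) (I z) := by
    have h3 := hfin.2
    simp only [extChartAt, chartAt_self_eq, mfld_simps] at h3
    exact h3
  rw [hz, I.right_inv hyr] at h2
  have hfun : (I ∘ ((s.trans c).symm.trans (s'.trans c')) ∘ I.symm) =
      I ∘ (c' ∘ s' ∘ π ∘ c.symm) ∘ I.symm := by
    funext w
    simp [Function.comp_apply, hsymm]
  rw [hfun]
  exact h2.mono inter_subset_right

/-- In the charts pushed forward along `π`, the derivative of `π` at a chosen representative is the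
identity. -/
theorem hasMFDerivAt_of_localHomeomorph (I : ModelWithCorners ℝ V H)
    {π : M → N} (hπ : IsLocalHomeomorph π) {σ : N → M} (hσ : Function.RightInverse σ π) (p : N) :
    letI : ChartedSpace H N := hπ.chartedSpaceOfRightInverse hσ
    HasMFDerivAt I I π (σ p) (ContinuousLinearMap.id ℝ V) := by
  let _ : ChartedSpace H N := hπ.chartedSpaceOfRightInverse hσ
  refine ⟨hπ.continuous.continuousAt, ?_⟩
  have hc : chartAt H (π (σ p)) = (hπ.localInverseAt (σ p)).trans (chartAt H (σ p)) := by
    rw [hσ p]; rfl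
  have hev : ∀ᶠ y in 𝓝[range I] (extChartAt I (σ p) (σ p)),
      writtenInExtChartAt I I (σ p) π y = y := by
    have h1 : ∀ᶠ y in 𝓝[range I] (extChartAt I (σ p) (σ p)), y ∈ (extChartAt I (σ p)).target :=
      extChartAt_target_mem_nhdsWithin (σ p)
    have h2 : ∀ᶠ y in 𝓝[range I] (extChartAt I (σ p) (σ p)),
        (extChartAt I (σ p)).symm y ∈ (hπ.localInverseAt (σ p)).target :=
      ((continuousAt_extChartAt_symm (I := I) (σ p)).mono_left nhdsWithin_le_nhds).eventually
        (by
          rw [extChartAt_to_inv]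
          exact (hπ.localInverseAt (σ p)).open_target.mem_nhds hπ.self_mem_localInverseAt_target)
    filter_upwards [h1, h2] with y hy1 hy2
    have h3 : hπ.localInverseAt (σ p) (π ((extChartAt I (σ p)).symm y)) =
        (extChartAt I (σ p)).symm y := by
      have h5 := (hπ.localInverseAt (σ p)).right_inv hy2
      rwa [hπ.localInverseAt_symm] at h5
    have h4 : extChartAt I (π (σ p)) (π ((extChartAt I (σ p)).symm y)) =
        extChartAt I (σ p) (hπ.localInverseAt (σ p) (π ((extChartAt I (σ p)).symm y))) := by
      simp only [extChartAt, hc]; rfl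
    rw [writtenInExtChartAt, Function.comp_apply, Function.comp_apply, h4, h3]
    exact (extChartAt I (σ p)).right_inv hy1
  exact (hasFDerivWithinAt_id _ _).congr_of_eventuallyEq hev
    (hev.self_of_nhdsWithin (mem_range_self _))

end Quotients

section MappingTorus

variable {E L : Type*} [NormedAddCommGroup E] [NormedSpace ℝ E]
  [TopologicalSpace L] [ChartedSpace E L]

/-- The action of `ℤ` on `L × ℝ` whose generator is `(x, t) ↦ (φ x, t + 1)`. -/
abbrev MappingTorus.action (φ : L ≃ₘ⟮𝓘(ℝ, E), 𝓘(ℝ, E)⟯ L) : AddAction ℤ (L × ℝ) where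
  vadd n q := (((φ.toEquiv : Equiv.Perm L) ^ n) q.1, q.2 + n)
  zero_vadd q := by
    change ((((φ.toEquiv : Equiv.Perm L) ^ (0 : ℤ)) q.1, q.2 + ((0 : ℤ) : ℝ)) : L × ℝ) = q
    simp
  add_vadd m n q := by
    change ((((φ.toEquiv : Equiv.Perm L) ^ (m + n)) q.1, q.2 + ((m + n : ℤ) : ℝ)) : L × ℝ) =
      (((φ.toEquiv : Equiv.Perm L) ^ m) (((φ.toEquiv : Equiv.Perm L) ^ n) q.1), q.2 + n + m)
    rw [zpow_add, Equiv.Perm.mul_apply]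
    push_cast
    rw [add_assoc, add_comm (n : ℝ)]

/-- The mapping torus `T_φ = (L × ℝ) / ((x, t) ∼ (φ x, t + 1))`. -/
def MappingTorus (φ : L ≃ₘ⟮𝓘(ℝ, E), 𝓘(ℝ, E)⟯ L) : Type _ :=
  @AddAction.orbitRel.Quotient ℤ (L × ℝ) _ (MappingTorus.action φ)

namespace MappingTorus

variable (φ : L ≃ₘ⟮𝓘(ℝ, E), 𝓘(ℝ, E)⟯ L)

/-- The quotient map `L × ℝ → T_φ`. -/
def mk (q : L × ℝ) : MappingTorus φ :=
  Quotient.mk (@AddAction.orbitRel ℤ (L × ℝ) _ (action φ)) q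

/-- A choice of representative in `L × ℝ` of each point of the mapping torus. -/
def rep (p : MappingTorus φ) : L × ℝ :=
  Quotient.out (s := @AddAction.orbitRel ℤ (L × ℝ) _ (action φ)) p

theorem rightInverse_rep : Function.RightInverse (rep φ) (mk φ) :=
  fun p => Quotient.out_eq (s := @AddAction.orbitRel ℤ (L × ℝ) _ (action φ)) p

theorem mk_eq_mk_iff {a b : L × ℝ} :
    mk φ a = mk φ b ↔ ∃ n : ℤ, (((φ.toEquiv : Equiv.Perm L) ^ n) b.1, b.2 + (n : ℝ)) = a := by
  let _ := action φ
  exact Quotient.eq.trans AddAction.orbitRel_apply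

theorem mk_apply_add_one (x : L) (t : ℝ) : mk φ (φ x, t + 1) = mk φ (x, t) :=
  (mk_eq_mk_iff φ).2 ⟨1, by simp⟩

theorem contMDiff_zpow (n : ℤ) :
    ContMDiff 𝓘(ℝ, E) 𝓘(ℝ, E) ∞ ((φ.toEquiv : Equiv.Perm L) ^ n) := by
  induction n with
  | zero => simpa using contMDiff_id
  | succ n ih =>
    have : ⇑((φ.toEquiv : Equiv.Perm L) ^ ((n : ℤ) + 1)) =
        ⇑((φ.toEquiv : Equiv.Perm L) ^ (n : ℤ)) ∘ φ := by
      rw [zpow_add_one]; rfl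
    rw [this]
    exact ih.comp φ.contMDiff
  | pred n ih =>
    have : ⇑((φ.toEquiv : Equiv.Perm L) ^ (-(n : ℤ) - 1)) =
        ⇑((φ.toEquiv : Equiv.Perm L) ^ (-(n : ℤ))) ∘ φ.symm := by
      rw [zpow_sub_one]; rfl
    rw [this]
    exact ih.comp φ.symm.contMDiff

/-- The transformation of `L × ℝ` by which the integer `n` acts. -/
def shift (n : ℤ) (q : L × ℝ) : L × ℝ :=
  (((φ.toEquiv : Equiv.Perm L) ^ n) q.1, q.2 + (n : ℝ))

theorem contMDiff_shift (n : ℤ) :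
    ContMDiff (𝓘(ℝ, E).prod 𝓘(ℝ, ℝ)) (𝓘(ℝ, E).prod 𝓘(ℝ, ℝ)) ∞
      (shift φ n) :=
  ((contMDiff_zpow φ n).comp contMDiff_fst).prodMk
    ((contDiff_id.add contDiff_const).contMDiff.comp contMDiff_snd)

/-- A one-form on `L × ℝ` that is invariant under the generator of the action is invariant under the
action. -/
theorem pullback_shift (γ : OneForm (𝓘(ℝ, E).prod 𝓘(ℝ, ℝ)) (L × ℝ))
    (hγ : OneForm.pullback (J := 𝓘(ℝ, E).prod 𝓘(ℝ, ℝ))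
      (fun q : L × ℝ => (φ q.1, q.2 + 1)) γ = γ) (n : ℤ) :
    OneForm.pullback (J := 𝓘(ℝ, E).prod 𝓘(ℝ, ℝ)) (shift φ n) γ = γ := by
  have hd : ∀ n, MDifferentiable (𝓘(ℝ, E).prod 𝓘(ℝ, ℝ)) (𝓘(ℝ, E).prod 𝓘(ℝ, ℝ)) (shift φ n) :=
    fun n => (contMDiff_shift φ n).mdifferentiable (by simp)
  have hadd : ∀ m n : ℤ, shift φ (m + n) = shift φ m ∘ shift φ n := fun m n => by
    let _ := action φ
    funext q
    exact add_vadd m n q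
  have h1 : shift φ 1 = fun q : L × ℝ => (φ q.1, q.2 + 1) := by
    funext q
    simp [shift]
  have h0 : shift φ 0 = id := by
    funext q
    simp [shift]
  rw [← h1] at hγ
  have hneg : OneForm.pullback (J := 𝓘(ℝ, E).prod 𝓘(ℝ, ℝ)) (shift φ (-1)) γ = γ := by
    conv_lhs => rw [← hγ]
    rw [OneForm.pullback_pullback _ _ _ (hd _) (hd _), ← hadd]
    simp only [add_neg_cancel, h0]
    exact OneForm.pullback_id γ
  induction n with
  | zero => rw [h0]; exact OneForm.pullback_id γ
  | succ n ih => rw [hadd, ← OneForm.pullback_pullback _ _ _ (hd _) (hd _), ih, hγ]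
  | pred n ih => rw [sub_eq_add_neg, hadd, ← OneForm.pullback_pullback _ _ _ (hd _) (hd _), ih, hneg]

/-- The quotient topology on the mapping torus. -/
instance : TopologicalSpace (MappingTorus φ) :=
  inferInstanceAs (TopologicalSpace (Quotient (@AddAction.orbitRel ℤ (L × ℝ) _ (action φ))))

theorem isLocalHomeomorph_mk [T2Space L] [LocallyCompactSpace L] :
    IsLocalHomeomorph (mk φ) := by
  let _ := action φ
  have : ContinuousConstVAdd ℤ (L × ℝ) := ⟨fun n => (contMDiff_shift φ n).continuous⟩
  have : IsCancelVAdd ℤ (L × ℝ) := ⟨fun m n q h => by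
    have h2 : q.2 + (m : ℝ) = q.2 + (n : ℝ) := congrArg Prod.snd h
    exact_mod_cast add_left_cancel h2⟩
  have : ProperlyDiscontinuousVAdd ℤ (L × ℝ) := ⟨fun {K K'} hK hK' => by
    obtain ⟨r, hr⟩ := (hK.image continuous_snd).isBounded.exists_norm_le
    obtain ⟨r', hr'⟩ := (hK'.image continuous_snd).isBounded.exists_norm_le
    refine (Set.finite_Icc (-⌈r + r'⌉) ⌈r + r'⌉).subset ?_
    rintro n ⟨_, ⟨q, hq, rfl⟩, hq'⟩
    have h1 := abs_le.1 (hr _ ⟨q, hq, rfl⟩)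
    have h2 : |q.2 + (n : ℝ)| ≤ r' := hr' _ ⟨_, hq', rfl⟩
    have h2 := abs_le.1 h2
    have h3 := Int.le_ceil (r + r')
    constructor
    · have : -((⌈r + r'⌉ : ℤ) : ℝ) ≤ n := by linarith [h1.1, h1.2, h2.1, h2.2]
      exact_mod_cast this
    · have : (n : ℝ) ≤ ((⌈r + r'⌉ : ℤ) : ℝ) := by linarith [h1.1, h1.2, h2.1, h2.2]
      exact_mod_cast this⟩
  exact isAddQuotientCoveringMap_quotientMk_of_properlyDiscontinuousVAdd.isCoveringMap
    |>.isLocalHomeomorph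

variable [T2Space L] [LocallyCompactSpace L]

/-- The charts of the mapping torus: local inverses of the quotient map `L × ℝ → T_φ` followed by
the charts of `L × ℝ`. -/
instance : ChartedSpace (ModelProd E ℝ) (MappingTorus φ) :=
  (isLocalHomeomorph_mk φ).chartedSpaceOfRightInverse (rightInverse_rep φ)

instance [IsManifold 𝓘(ℝ, E) ∞ L] :
    IsManifold (𝓘(ℝ, E).prod 𝓘(ℝ, ℝ)) ∞ (MappingTorus φ) :=
  isManifold_of_localHomeomorph _ (isLocalHomeomorph_mk φ) (rightInverse_rep φ) fun a b hab => by
    obtain ⟨n, hn⟩ := (mk_eq_mk_iff φ).1 hab.symm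
    exact ⟨_, contMDiff_shift φ n, hn, fun x => (mk_eq_mk_iff φ).2 ⟨n, rfl⟩⟩

variable {φ} in
/-- The one-form on the mapping torus whose value at `p = [q]`, for the chosen representative `q`
of `p`, is the value of `γ` at `q`, transported by the derivative of the quotient map at `q`. If `γ`
is invariant under `(x, t) ↦ (φ x, t + 1)`, this is the one-form to which `γ` descends. -/
def descend (γ : OneForm (𝓘(ℝ, E).prod 𝓘(ℝ, ℝ)) (L × ℝ)) :
    OneForm (𝓘(ℝ, E).prod 𝓘(ℝ, ℝ)) (MappingTorus φ) :=
  fun p => (γ (rep φ p)).comp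
    (mfderiv (𝓘(ℝ, E).prod 𝓘(ℝ, ℝ)) (𝓘(ℝ, E).prod 𝓘(ℝ, ℝ)) (mk φ) (rep φ p)).inverse

/-- A one-form on `L × ℝ` that is invariant under the generator of the action is the pullback under
the quotient map of the one-form to which it descends. -/
theorem pullback_descend (γ : OneForm (𝓘(ℝ, E).prod 𝓘(ℝ, ℝ)) (L × ℝ))
    (hγ : OneForm.pullback (J := 𝓘(ℝ, E).prod 𝓘(ℝ, ℝ))
      (fun q : L × ℝ => (φ q.1, q.2 + 1)) γ = γ) :
    OneForm.pullback (J := 𝓘(ℝ, E).prod 𝓘(ℝ, ℝ)) (mk φ) (descend γ) = γ := by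
  funext q
  have hrep := hasMFDerivAt_of_localHomeomorph (𝓘(ℝ, E).prod 𝓘(ℝ, ℝ)) (isLocalHomeomorph_mk φ)
    (rightInverse_rep φ) (mk φ q)
  obtain ⟨n, hn⟩ := (mk_eq_mk_iff φ).1 (rightInverse_rep φ (mk φ q))
  have hn : shift φ n q = rep φ (mk φ q) := hn
  have hinv : (mfderiv (𝓘(ℝ, E).prod 𝓘(ℝ, ℝ)) (𝓘(ℝ, E).prod 𝓘(ℝ, ℝ)) (mk φ)
      (rep φ (mk φ q))).inverse = ContinuousLinearMap.id ℝ (E × ℝ) := by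
    rw [hrep.mfderiv]
    exact ContinuousLinearMap.inverse_id
  have hshift : HasMFDerivAt (𝓘(ℝ, E).prod 𝓘(ℝ, ℝ)) (𝓘(ℝ, E).prod 𝓘(ℝ, ℝ)) (shift φ n) q _ :=
    (((contMDiff_shift φ n).mdifferentiable (by simp)) q).hasMFDerivAt
  have hmk : mk φ = mk φ ∘ shift φ n := by
    funext r
    exact (mk_eq_mk_iff φ).2 ⟨-n, by
      let _ := action φ
      exact neg_vadd_vadd n r⟩
  have hq : mfderiv (𝓘(ℝ, E).prod 𝓘(ℝ, ℝ)) (𝓘(ℝ, E).prod 𝓘(ℝ, ℝ)) (mk φ) q =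
      mfderiv (𝓘(ℝ, E).prod 𝓘(ℝ, ℝ)) (𝓘(ℝ, E).prod 𝓘(ℝ, ℝ)) (shift φ n) q := by
    have h2 : HasMFDerivAt (𝓘(ℝ, E).prod 𝓘(ℝ, ℝ)) (𝓘(ℝ, E).prod 𝓘(ℝ, ℝ)) (mk φ)
        (shift φ n q) (ContinuousLinearMap.id ℝ (E × ℝ)) := by
      rw [hn]; exact hrep
    have h3 := (HasMFDerivAt.comp q h2 hshift).mfderiv
    rw [← hmk] at h3
    exact h3
  have hγn := congrFun (pullback_shift φ γ hγ n) q
  have key : ∀ r : L × ℝ, shift φ n q = r →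
      (show E × ℝ →L[ℝ] ℝ from γ r).comp (show E × ℝ →L[ℝ] E × ℝ from
        mfderiv (𝓘(ℝ, E).prod 𝓘(ℝ, ℝ)) (𝓘(ℝ, E).prod 𝓘(ℝ, ℝ)) (shift φ n) q) = γ q := by
    rintro r rfl
    exact hγn
  change ((γ (rep φ (mk φ q))).comp _).comp _ = _
  rw [hinv, hq]
  exact key _ hn

/-- The projection `T_φ → S¹ = ℝ/ℤ`, `[x, t] ↦ t`, where `ℝ/ℤ` is identified with the unit circle by
`t ↦ exp (2 π i t)`. -/
def toCircle : MappingTorus φ → Circle :=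
  Quotient.lift (s := @AddAction.orbitRel ℤ (L × ℝ) _ (action φ))
    (fun q => Circle.exp (2 * Real.pi * q.2)) fun a b hab => by
      obtain ⟨n, rfl⟩ := (mk_eq_mk_iff φ).1 (Quotient.sound hab)
      change Circle.exp (2 * Real.pi * (b.2 + n)) = _
      rw [mul_add, mul_comm (2 * Real.pi) (n : ℝ)]
      exact Circle.periodic_exp.int_mul n _

/-- The one-form `ω₁ = e^{-λ t} α` on the mapping torus, where `lam` is `λ`. -/
def modelForm₁ (α : OneForm 𝓘(ℝ, E) L) (lam : ℝ) :
    OneForm (𝓘(ℝ, E).prod 𝓘(ℝ, ℝ)) (MappingTorus φ) :=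
  descend fun q => Real.exp (-lam * q.2) • OneForm.pullback Prod.fst α q

theorem pullback_modelForm₁ (α : OneForm 𝓘(ℝ, E) L) (lam : ℝ)
    (hα : OneForm.pullback (J := 𝓘(ℝ, E)) φ α = fun x => Real.exp lam • α x) :
    OneForm.pullback (J := 𝓘(ℝ, E).prod 𝓘(ℝ, ℝ)) (mk φ) (modelForm₁ φ α lam) =
      fun q => Real.exp (-lam * q.2) • OneForm.pullback Prod.fst α q := by
  refine pullback_descend φ _ ?_
  funext q
  have hsh : MDifferentiable (𝓘(ℝ, E).prod 𝓘(ℝ, ℝ)) (𝓘(ℝ, E).prod 𝓘(ℝ, ℝ))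
      (fun q : L × ℝ => (φ q.1, q.2 + 1)) := by
    have h := (contMDiff_shift φ 1).mdifferentiable (by simp)
    have h1 : shift φ 1 = fun q : L × ℝ => (φ q.1, q.2 + 1) := by
      funext q
      simp [shift]
    rwa [h1] at h
  have hφ : MDifferentiable 𝓘(ℝ, E) 𝓘(ℝ, E) φ := φ.contMDiff.mdifferentiable (by simp)
  have hfst : MDifferentiable (𝓘(ℝ, E).prod 𝓘(ℝ, ℝ)) 𝓘(ℝ, E) (Prod.fst : L × ℝ → L) :=
    mdifferentiable_fst
  have h1 := OneForm.pullback_pullback (Prod.fst : L × ℝ → L) (fun q : L × ℝ => (φ q.1, q.2 + 1))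
    α hfst hsh
  have h2 := OneForm.pullback_pullback φ (Prod.fst : L × ℝ → L) α hφ hfst
  have h3 := congrFun (h1.trans h2.symm) q
  rw [hα] at h3
  have h4 : Real.exp (-lam * (q.2 + 1)) * Real.exp lam = Real.exp (-lam * q.2) := by
    rw [← Real.exp_add]; ring_nf
  change Real.exp (-lam * (q.2 + 1)) • OneForm.pullback (J := 𝓘(ℝ, E).prod 𝓘(ℝ, ℝ))
    (fun q : L × ℝ => (φ q.1, q.2 + 1)) (OneForm.pullback Prod.fst α) q = _
  rw [h3, ← h4, mul_smul]
  rfl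

/-- The one-form `ω₂ = -λ dt` on the mapping torus, where `lam` is `λ`. -/
def modelForm₂ (lam : ℝ) : OneForm (𝓘(ℝ, E).prod 𝓘(ℝ, ℝ)) (MappingTorus φ) :=
  descend fun q => -lam • OneForm.differential (𝓘(ℝ, E).prod 𝓘(ℝ, ℝ)) Prod.snd q

theorem pullback_modelForm₂ (lam : ℝ) :
    OneForm.pullback (J := 𝓘(ℝ, E).prod 𝓘(ℝ, ℝ)) (mk φ) (modelForm₂ φ lam) =
      fun q => -lam • OneForm.differential (𝓘(ℝ, E).prod 𝓘(ℝ, ℝ)) Prod.snd q := by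
  refine pullback_descend φ _ ?_
  funext q
  have hsh : MDifferentiable (𝓘(ℝ, E).prod 𝓘(ℝ, ℝ)) (𝓘(ℝ, E).prod 𝓘(ℝ, ℝ))
      (fun q : L × ℝ => (φ q.1, q.2 + 1)) := by
    have h := (contMDiff_shift φ 1).mdifferentiable (by simp)
    have h1 : shift φ 1 = fun q : L × ℝ => (φ q.1, q.2 + 1) := by
      funext q
      simp [shift]
    rwa [h1] at h
  have h1 : mfderiv (𝓘(ℝ, E).prod 𝓘(ℝ, ℝ)) 𝓘(ℝ, ℝ)
      (Prod.snd ∘ fun q : L × ℝ => (φ q.1, q.2 + 1)) q =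
      (mfderiv (𝓘(ℝ, E).prod 𝓘(ℝ, ℝ)) 𝓘(ℝ, ℝ) Prod.snd (φ q.1, q.2 + 1)).comp
        (mfderiv (𝓘(ℝ, E).prod 𝓘(ℝ, ℝ)) (𝓘(ℝ, E).prod 𝓘(ℝ, ℝ))
          (fun q : L × ℝ => (φ q.1, q.2 + 1)) q) :=
    mfderiv_comp q mdifferentiableAt_snd (hsh q)
  have h2 : HasMFDerivAt (𝓘(ℝ, E).prod 𝓘(ℝ, ℝ)) 𝓘(ℝ, ℝ)
      ((fun t : ℝ => t + 1) ∘ (Prod.snd : L × ℝ → ℝ)) q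
      ((ContinuousLinearMap.id ℝ ℝ).comp
        (mfderiv (𝓘(ℝ, E).prod 𝓘(ℝ, ℝ)) 𝓘(ℝ, ℝ) (Prod.snd : L × ℝ → ℝ) q)) :=
    HasMFDerivAt.comp q ((hasFDerivAt_id q.2).add_const 1).hasMFDerivAt
      mdifferentiableAt_snd.hasMFDerivAt
  have h3 := h1.symm.trans h2.mfderiv
  change -lam • (mfderiv (𝓘(ℝ, E).prod 𝓘(ℝ, ℝ)) 𝓘(ℝ, ℝ) Prod.snd (φ q.1, q.2 + 1)).comp
        (mfderiv (𝓘(ℝ, E).prod 𝓘(ℝ, ℝ)) (𝓘(ℝ, E).prod 𝓘(ℝ, ℝ))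
          (fun q : L × ℝ => (φ q.1, q.2 + 1)) q) = _
  rw [h3]
  rfl

/-- The tangent distribution `ker ω₁ ∩ ker ω₂` of the model foliation `G_{α,λ}`. -/
def modelFoliation (α : OneForm 𝓘(ℝ, E) L) (lam : ℝ) (p : MappingTorus φ) :
    Submodule ℝ (TangentSpace (𝓘(ℝ, E).prod 𝓘(ℝ, ℝ)) p) :=
  LinearMap.ker (modelForm₁ φ α lam p).toLinearMap ⊓ LinearMap.ker (modelForm₂ φ lam p).toLinearMap

end MappingTorus
end MappingTorus

/-! ### Smooth one-forms in charts, and naturality of the exterior derivative. -/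

section LocalForms

variable {V H M : Type*} [NormedAddCommGroup V] [NormedSpace ℝ V] [TopologicalSpace H]
  [TopologicalSpace M] [ChartedSpace H M] {I : ModelWithCorners ℝ V H}

/-! Everything is computed on the cover `L × ℝ`. Since ζ₁ and ζ₂ vanish on the leaves, their
pullbacks have the form ζ₁ = A α + B dt and ζ₂ = C α + D dt with smooth functions of (x, t)
(`exists_hasCoefficients`). Invariance under the deck transformation (x, t) ↦ (φ x, t + 1) says that
B and D are invariant and that A(φ x, t + 1) e^λ = A(x, t), and likewise for C.

The central point is rigidity along L (`eq_of_basic`). If dh ∧ α = 0 on L, then |dh| ≤ κ|α| by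
compactness. Composing h with the n-th iterate of whichever of φ, φ⁻¹ contracts α multiplies this
bound by e^{-n|λ|}, while the oscillation of h stays the same because the iterates are surjective. A
bound on oscillation that is linear in κ then forces h to be constant.

As α is closed, the L–L component of each structure equation is dC ∧ α = 0, respectively dA ∧ α = 0,
along L, so C and A depend on t only. The mixed component says that d_L D = C' α, respectively d_L B
= (A' - D A) α once C = 0 is known. At a maximum on the compact L the left side vanishes but α does
not, so the factor is zero and D, respectively B, is constant along L. Hence C' = 0, and
equivariance with e^λ ≠ 1 gives C = 0; for ζ₁ one gets A' = D A.

What remains is an ODE problem on the line (`exists_periodic_normal_form`). With P = ∫ D,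
equivariance of A makes F = P + λt periodic, and A = K e^F e^{-λt}, where K ≠ 0 by linear
independence. Finally B = e^F (G' + λG) has a periodic solution G, again because e^λ ≠ 1. The
functions F and G descend to f and g on the circle. -/

theorem OneForm.IsSmooth.contDiffAt_inChart [I.Boundaryless] [IsManifold I ∞ M]
    {β : OneForm I M} (hβ : β.IsSmooth) (p : M) :
    ContDiffAt ℝ ∞ (β.inChart p) (extChartAt I p p) := by
  have h1 := (contMDiffAt_hom_bundle (E₁ := (TangentSpace I : M → Type _))
    (E₂ := Bundle.Trivial M ℝ) _).1 (hβ p)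
  have h2 := h1.2
  have h3 : ContMDiffAt 𝓘(ℝ, V) I ∞ (extChartAt I p).symm (extChartAt I p p) :=
    (contMDiffOn_extChartAt_symm p).contMDiffAt (extChartAt_target_mem_nhds p)
  have h4 := ContMDiffAt.comp_of_eq h2 h3 (extChartAt_to_inv p)
  rw [contMDiffAt_iff_contDiffAt] at h4
  refine h4.congr_of_eventuallyEq ?_
  filter_upwards [extChartAt_target_mem_nhds (I := I) p] with y hy
  have hys : (extChartAt I p).symm y ∈ (chartAt H p).source := by
    simpa using (extChartAt I p).map_target hy
  simp only [Function.comp_apply, OneForm.inChart]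
  ext v
  -- The inverse of the tangent trivialization is the derivative of the inverse chart, so smoothness
  -- as a bundle section is smoothness of `inChart`.
  have h5 := congrArg (fun l => l v) (TangentBundle.symmL_trivializationAt (I := I) hys)
  rw [(extChartAt I p).right_inv hy] at h5
  refine (congrArg (β ((extChartAt I p).symm y)) h5.symm).trans ?_
  simp only [ContinuousLinearMap.inCoordinates, ContinuousLinearMap.comp_apply]
  simp

theorem OneForm.IsSmooth.extDeriv_eq_fderiv [I.Boundaryless] [IsManifold I ∞ M]
    {β : OneForm I M} (hβ : β.IsSmooth) (p : M) (u v : V) :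
    β.extDeriv p u v = fderiv ℝ (β.inChart p) (extChartAt I p p) u v -
      fderiv ℝ (β.inChart p) (extChartAt I p p) v u := by
  have hd : DifferentiableAt ℝ (β.inChart p) (extChartAt I p p) :=
    (hβ.contDiffAt_inChart p).differentiableAt (by simp)
  let T : (V →L[ℝ] ℝ) →L[ℝ] V [⋀^Fin 1]→L[ℝ] ℝ :=
    (ContinuousAlternatingMap.ofSubsingletonLIE (𝕜 := ℝ) (E := V) (F := ℝ)
      (0 : Fin 1)).toContinuousLinearEquiv.toContinuousLinearMap
  have h1 : fderiv ℝ (fun y => ContinuousAlternatingMap.ofSubsingleton ℝ V ℝ (0 : Fin 1)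
      (β.inChart p y)) (extChartAt I p p) = T.comp (fderiv ℝ (β.inChart p) (extChartAt I p p)) :=
    (T.hasFDerivAt.comp (extChartAt I p p) hd.hasFDerivAt).fderiv
  change extDerivWithin (fun y => ContinuousAlternatingMap.ofSubsingleton ℝ V ℝ (0 : Fin 1)
      (β.inChart p y)) (range I) (extChartAt I p p) ![u, v] = _
  rw [I.range_eq_univ, extDerivWithin, fderivWithin_univ, h1]
  simp [ContinuousAlternatingMap.alternatizeUncurryFin_apply, Fin.sum_univ_two]
  rfl

/-- The pullback of `β` under a map from a normed space, as a covector-valued map. -/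
def OneForm.onSpace {V' : Type*} [NormedAddCommGroup V'] [NormedSpace ℝ V'] (β : OneForm I M)
    (ψ : V' → M) (y : V') : V' →L[ℝ] ℝ :=
  (β (ψ y) : V →L[ℝ] ℝ).comp (mfderiv 𝓘(ℝ, V') I ψ y : V' →L[ℝ] V)

/-- Near `y₀`, the pullback of `β` under `ψ` is the pullback of its expression in a chart under the
expression of `ψ` in that chart. -/
theorem OneForm.pullback_eventuallyEq {V' : Type*} [NormedAddCommGroup V'] [NormedSpace ℝ V']
    [I.Boundaryless] [IsManifold I ∞ M] (β : OneForm I M) {ψ : V' → M} {y₀ : V'}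
    (hψ : ContMDiffAt 𝓘(ℝ, V') I ∞ ψ y₀) :
    β.onSpace ψ =ᶠ[𝓝 y₀]
      fun y => (β.inChart (ψ y₀) (extChartAt I (ψ y₀) (ψ y))).comp
        (fderiv ℝ (fun z => extChartAt I (ψ y₀) (ψ z)) y) := by
  have hs : ∀ᶠ y in 𝓝 y₀, ψ y ∈ (extChartAt I (ψ y₀)).source :=
    hψ.continuousAt.eventually (extChartAt_source_mem_nhds (I := I) (ψ y₀))
  have hd : ∀ᶠ y in 𝓝 y₀, ContMDiffAt 𝓘(ℝ, V') I 1 ψ y :=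
    (contMDiffAt_iff_contMDiffAt_nhds (by simp)).1 (hψ.of_le (by simp))
  filter_upwards [hs.eventually_nhds, hd] with y hy hyd
  have hy0 := hy.self_of_nhds
  set e := extChartAt I (ψ y₀) with he
  have hτ : MDifferentiableAt 𝓘(ℝ, V') 𝓘(ℝ, V) (fun z => e (ψ z)) y :=
    (mdifferentiableAt_extChartAt (by simpa [he] using hy0)).comp y
      (hyd.mdifferentiableAt (by simp))
  have hsymm : MDifferentiableAt 𝓘(ℝ, V) I e.symm (e (ψ y)) :=
    ((contMDiffOn_extChartAt_symm (I := I) (n := 1) (ψ y₀)).contMDiffAt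
      ((isOpen_extChartAt_target (ψ y₀)).mem_nhds (e.map_source hy0))).mdifferentiableAt (by simp)
  have h1 : ψ =ᶠ[𝓝 y] e.symm ∘ fun z => e (ψ z) := by
    filter_upwards [hy] with z hz
    exact (e.left_inv hz).symm
  have h2 := mfderiv_comp y hsymm hτ
  rw [← h1.mfderiv_eq, mfderiv_eq_fderiv] at h2
  have h3 : ∀ r, r = ψ y → ((β r : V →L[ℝ] ℝ).comp (mfderiv 𝓘(ℝ, V) I e.symm (e (ψ y)) :
      V →L[ℝ] V)).comp (fderiv ℝ (fun z => e (ψ z)) y) =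
      (β (ψ y) : V →L[ℝ] ℝ).comp (mfderiv 𝓘(ℝ, V') I ψ y : V' →L[ℝ] V) := by
    rintro r rfl
    rw [h2]
    rfl
  rw [OneForm.inChart, I.range_eq_univ, mfderivWithin_univ]
  exact (h3 _ (e.left_inv hy0)).symm

theorem OneForm.IsSmooth.contDiffAt_pullback {V' : Type*} [NormedAddCommGroup V']
    [NormedSpace ℝ V'] [I.Boundaryless] [IsManifold I ∞ M] {β : OneForm I M} (hβ : β.IsSmooth)
    {ψ : V' → M} {y₀ : V'} (hψ : ContMDiffAt 𝓘(ℝ, V') I ∞ ψ y₀) :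
    ContDiffAt ℝ ∞ (β.onSpace ψ) y₀ := by
  refine ContDiffAt.congr_of_eventuallyEq ?_ (β.pullback_eventuallyEq hψ)
  have hτ : ContDiffAt ℝ ∞ (fun z => extChartAt I (ψ y₀) (ψ z)) y₀ :=
    (contMDiffAt_extChartAt.comp y₀ hψ).contDiffAt
  exact ((hβ.contDiffAt_inChart (ψ y₀)).comp y₀ hτ).clm_comp
    (hτ.fderiv_right le_rfl)

/-- Naturality of the exterior derivative. -/
theorem OneForm.IsSmooth.fderiv_pullback_sub {V' : Type*} [NormedAddCommGroup V']
    [NormedSpace ℝ V'] [I.Boundaryless] [IsManifold I ∞ M] {β : OneForm I M} (hβ : β.IsSmooth)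
    {ψ : V' → M} {y₀ : V'} (hψ : ContMDiffAt 𝓘(ℝ, V') I ∞ ψ y₀) (u v : V') :
    fderiv ℝ (β.onSpace ψ) y₀ u v -
      fderiv ℝ (β.onSpace ψ) y₀ v u =
    β.extDeriv (ψ y₀) (mfderiv 𝓘(ℝ, V') I ψ y₀ u) (mfderiv 𝓘(ℝ, V') I ψ y₀ v) := by
  rw [(β.pullback_eventuallyEq hψ).fderiv_eq]
  set τ : V' → V := fun z => extChartAt I (ψ y₀) (ψ z) with hτ_def
  have hτ : ContDiffAt ℝ ∞ τ y₀ :=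
    (contMDiffAt_extChartAt.comp y₀ hψ).contDiffAt
  have hτ' : DifferentiableAt ℝ (fderiv ℝ τ) y₀ :=
    (hτ.fderiv_right (m := 1) (WithTop.coe_le_coe.2 le_top)).differentiableAt (by simp)
  have hb : DifferentiableAt ℝ (β.inChart (ψ y₀)) (τ y₀) :=
    (hβ.contDiffAt_inChart (ψ y₀)).differentiableAt (by simp)
  have hbτ := hb.hasFDerivAt.comp y₀ (hτ.differentiableAt (by simp)).hasFDerivAt
  have hψτ : mfderiv 𝓘(ℝ, V') I ψ y₀ = fderiv ℝ τ y₀ := by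
    refine (hψ.mdifferentiableAt (by simp)).mfderiv.trans ?_
    simp [writtenInExtChartAt, Function.comp_def, hτ_def]
    rfl
  -- The product rule produces a second-derivative term of `τ`; it is symmetric, so
  -- antisymmetrization removes it.
  have hsym : fderiv ℝ (fderiv ℝ τ) y₀ u v = fderiv ℝ (fderiv ℝ τ) y₀ v u :=
    (hτ.isSymmSndFDerivAt (by simpa using WithTop.coe_le_coe.2 (le_top : (2 : ℕ∞) ≤ ⊤))).eq u v
  have hc := (hbτ.clm_comp hτ'.hasFDerivAt).fderiv
  rw [hψτ]
  refine (congrArg₂ (· - ·) (congrArg (fun l => l u v) hc) (congrArg (fun l => l v u) hc)).trans ?_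
  refine Eq.trans ?_ (hβ.extDeriv_eq_fderiv (ψ y₀) (fderiv ℝ τ y₀ u) (fderiv ℝ τ y₀ v)).symm
  simp only [_root_.add_apply, ContinuousLinearMap.comp_apply,
    ContinuousLinearMap.compL_apply, ContinuousLinearMap.flip_apply, hsym]
  exact add_sub_add_left_eq_sub _ _ _

end LocalForms
-- Smoothness and derivatives through a local homeomorphism.
section Quotients

variable {V H M N : Type*} [NormedAddCommGroup V] [NormedSpace ℝ V] [TopologicalSpace H]
  [TopologicalSpace M] [ChartedSpace H M] [TopologicalSpace N]

/-- The chart at `p` is the chart at `σ p` precomposed with a local inverse of `π`, so `π` reads as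
the identity near `σ p`. -/
theorem contMDiffAt_of_localHomeomorph (I : ModelWithCorners ℝ V H)
    {π : M → N} (hπ : IsLocalHomeomorph π) {σ : N → M} (hσ : Function.RightInverse σ π) (p : N) :
    letI : ChartedSpace H N := hπ.chartedSpaceOfRightInverse hσ
    ContMDiffAt I I ∞ π (σ p) := by
  let _ : ChartedSpace H N := hπ.chartedSpaceOfRightInverse hσ
  refine contMDiffAt_iff.2 ⟨hπ.continuous.continuousAt, ?_⟩
  have hc : chartAt H (π (σ p)) = (hπ.localInverseAt (σ p)).trans (chartAt H (σ p)) := by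
    rw [hσ p]; rfl
  have hev : ∀ᶠ y in 𝓝[range I] (extChartAt I (σ p) (σ p)),
      (extChartAt I (π (σ p)) ∘ π ∘ (extChartAt I (σ p)).symm) y = y := by
    have h1 : ∀ᶠ y in 𝓝[range I] (extChartAt I (σ p) (σ p)), y ∈ (extChartAt I (σ p)).target :=
      extChartAt_target_mem_nhdsWithin (σ p)
    have h2 : ∀ᶠ y in 𝓝[range I] (extChartAt I (σ p) (σ p)),
        (extChartAt I (σ p)).symm y ∈ (hπ.localInverseAt (σ p)).target :=
      ((continuousAt_extChartAt_symm (I := I) (σ p)).mono_left nhdsWithin_le_nhds).eventually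
        (by
          rw [extChartAt_to_inv]
          exact (hπ.localInverseAt (σ p)).open_target.mem_nhds hπ.self_mem_localInverseAt_target)
    filter_upwards [h1, h2] with y hy1 hy2
    have h3 : hπ.localInverseAt (σ p) (π ((extChartAt I (σ p)).symm y)) =
        (extChartAt I (σ p)).symm y := by
      have h5 := (hπ.localInverseAt (σ p)).right_inv hy2
      rwa [hπ.localInverseAt_symm] at h5
    have h4 : extChartAt I (π (σ p)) (π ((extChartAt I (σ p)).symm y)) =
        extChartAt I (σ p) (hπ.localInverseAt (σ p) (π ((extChartAt I (σ p)).symm y))) := by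
      simp only [extChartAt, hc]; rfl
    rw [Function.comp_apply, Function.comp_apply, h4, h3]
    exact (extChartAt I (σ p)).right_inv hy1
  exact contDiffWithinAt_id.congr_of_eventuallyEq hev (hev.self_of_nhdsWithin (mem_range_self _))

/-- In the charts pushed forward along `π`, a real function on `N` has the derivative at a point
that its composition with `π` has at the chosen representative. -/
theorem hasMFDerivAt_of_comp_localHomeomorph (I : ModelWithCorners ℝ V H)
    {π : M → N} (hπ : IsLocalHomeomorph π) {σ : N → M} (hσ : Function.RightInverse σ π) (p : N)
    {g : N → ℝ} {A : V →L[ℝ] ℝ} (hg : HasMFDerivAt I 𝓘(ℝ, ℝ) (g ∘ π) (σ p) A) :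
    letI : ChartedSpace H N := hπ.chartedSpaceOfRightInverse hσ
    HasMFDerivAt I 𝓘(ℝ, ℝ) g p A := by
  let _ : ChartedSpace H N := hπ.chartedSpaceOfRightInverse hσ
  have hcont : ContinuousAt g p := by
    have h1 := hg.1
    -- A local homeomorphism carries neighbourhood filters to neighbourhood filters, so continuity
    -- of `g ∘ π` passes to `g`.
    rw [ContinuousAt, ← Filter.tendsto_map'_iff, hπ.map_nhds_eq, hσ p] at h1
    simpa [ContinuousAt, hσ p] using h1
  refine ⟨hcont, ?_⟩
  have hsymm : ∀ y, (extChartAt I p).symm y = π ((extChartAt I (σ p)).symm y) := fun y => by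
    change (hπ.localInverseAt (σ p)).symm _ = _
    rw [hπ.localInverseAt_symm]
    rfl
  have hp : extChartAt I p p = extChartAt I (σ p) (σ p) := by
    change extChartAt I (σ p) (hπ.localInverseAt (σ p) p) = _
    congr 1
    have h5 := (hπ.localInverseAt (σ p)).right_inv hπ.self_mem_localInverseAt_target
    rwa [hπ.localInverseAt_symm, hσ p] at h5
  have h2 := hg.2
  have hw : writtenInExtChartAt I 𝓘(ℝ, ℝ) p g = writtenInExtChartAt I 𝓘(ℝ, ℝ) (σ p) (g ∘ π) := by
    funext y
    simp only [writtenInExtChartAt, Function.comp_apply, hsymm]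
    rfl
  rw [hw, hp]
  exact h2

end Quotients

/-! ### Lifting one-forms from the mapping torus to the cover. -/

namespace MappingTorus

variable {E L : Type*} [NormedAddCommGroup E] [NormedSpace ℝ E]
  [TopologicalSpace L] [ChartedSpace E L] (φ : L ≃ₘ⟮𝓘(ℝ, E), 𝓘(ℝ, E)⟯ L)

theorem mk_shift (n : ℤ) (q : L × ℝ) : mk φ (shift φ n q) = mk φ q :=
  (mk_eq_mk_iff φ).2 ⟨n, rfl⟩

theorem toCircle_mk (q : L × ℝ) : toCircle φ (mk φ q) = Circle.exp (2 * Real.pi * q.2) := rfl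

variable [T2Space L] [LocallyCompactSpace L]

/-- At chosen representatives the quotient map is the identity in charts; every other point is
carried to one by a deck transformation, which is smooth and lies over the identity. -/
theorem contMDiff_mk :
    ContMDiff (𝓘(ℝ, E).prod 𝓘(ℝ, ℝ)) (𝓘(ℝ, E).prod 𝓘(ℝ, ℝ)) ∞ (mk φ) := fun q => by
  obtain ⟨n, hn⟩ := (mk_eq_mk_iff φ).1 (rightInverse_rep φ (mk φ q))
  have hn : shift φ n q = rep φ (mk φ q) := hn
  have h1 : ContMDiffAt (𝓘(ℝ, E).prod 𝓘(ℝ, ℝ)) (𝓘(ℝ, E).prod 𝓘(ℝ, ℝ)) ∞ (mk φ)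
      (rep φ (mk φ q)) :=
    contMDiffAt_of_localHomeomorph _ (isLocalHomeomorph_mk φ) (rightInverse_rep φ) (mk φ q)
  have hmk : mk φ = mk φ ∘ shift φ n := funext fun r => (mk_shift φ n r).symm
  rw [hmk]
  exact h1.comp_of_eq (contMDiff_shift φ n q) hn

theorem mfderiv_mk_rep (p : MappingTorus φ) :
    mfderiv (𝓘(ℝ, E).prod 𝓘(ℝ, ℝ)) (𝓘(ℝ, E).prod 𝓘(ℝ, ℝ)) (mk φ) (rep φ p) =
      ContinuousLinearMap.id ℝ (E × ℝ) :=
  (hasMFDerivAt_of_localHomeomorph _ (isLocalHomeomorph_mk φ) (rightInverse_rep φ) p).mfderiv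

variable {φ}

/-- The pullback of a one-form on the mapping torus to `L × ℝ`, as a covector on `E × ℝ`. -/
def lift (ζ : OneForm (𝓘(ℝ, E).prod 𝓘(ℝ, ℝ)) (MappingTorus φ)) (q : L × ℝ) : E × ℝ →L[ℝ] ℝ :=
  OneForm.pullback (J := 𝓘(ℝ, E).prod 𝓘(ℝ, ℝ)) (mk φ) ζ q

/-- The quotient map has identity derivative at chosen representatives, so a form on the mapping
torus can be read off from its lift there. -/
theorem lift_rep (ζ : OneForm (𝓘(ℝ, E).prod 𝓘(ℝ, ℝ)) (MappingTorus φ)) (p : MappingTorus φ)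
    (v : E × ℝ) : lift ζ (rep φ p) v = ζ p v := by
  have h : ∀ r, r = p → (ζ r : E × ℝ →L[ℝ] ℝ)
      ((mfderiv (𝓘(ℝ, E).prod 𝓘(ℝ, ℝ)) (𝓘(ℝ, E).prod 𝓘(ℝ, ℝ)) (mk φ) (rep φ p) :
        E × ℝ →L[ℝ] E × ℝ) v) = ζ p v := by
    rintro r rfl
    rw [mfderiv_mk_rep]
    rfl
  exact h _ (rightInverse_rep φ p)

/-- The chain rule for `mk φ` composed with the generator of the deck group, a composite that equals
`mk φ`. -/
theorem lift_apply_add_one (ζ : OneForm (𝓘(ℝ, E).prod 𝓘(ℝ, ℝ)) (MappingTorus φ)) (x : L) (t : ℝ)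
    (u : E) (s : ℝ) :
    lift ζ (φ x, t + 1) ((mfderiv 𝓘(ℝ, E) 𝓘(ℝ, E) φ x : E →L[ℝ] E) u, s) =
      lift ζ (x, t) (u, s) := by
  have hφ : HasMFDerivAt 𝓘(ℝ, E) 𝓘(ℝ, E) φ x (mfderiv 𝓘(ℝ, E) 𝓘(ℝ, E) φ x) :=
    (φ.contMDiff.mdifferentiable (by simp) x).hasMFDerivAt
  have h1 := HasMFDerivAt.comp (I := 𝓘(ℝ, E).prod 𝓘(ℝ, ℝ)) (x, t) hφ
    (hasMFDerivAt_fst (I := 𝓘(ℝ, E)) (I' := 𝓘(ℝ, ℝ)) (x, t))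
  have h2 := HasMFDerivAt.comp (I := 𝓘(ℝ, E).prod 𝓘(ℝ, ℝ)) (x, t)
    ((hasFDerivAt_id t).add_const (1 : ℝ)).hasMFDerivAt
    (hasMFDerivAt_snd (I := 𝓘(ℝ, E)) (I' := 𝓘(ℝ, ℝ)) (x, t))
  have h3 := (h1.prodMk h2)
  have hmk : mk φ = mk φ ∘ fun q : L × ℝ => (φ q.1, q.2 + 1) :=
    funext fun q => (mk_apply_add_one φ q.1 q.2).symm
  have h4 : HasMFDerivAt (𝓘(ℝ, E).prod 𝓘(ℝ, ℝ)) (𝓘(ℝ, E).prod 𝓘(ℝ, ℝ)) (mk φ) (φ x, t + 1) _ :=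
    ((contMDiff_mk φ).mdifferentiable (by simp) _).hasMFDerivAt
  have h5 := (h4.comp (x, t) h3).mfderiv
  change mfderiv _ _ (mk φ ∘ fun q : L × ℝ => (φ q.1, q.2 + 1)) (x, t) = _ at h5
  rw [← hmk] at h5
  have h6 : ∀ r, r = mk φ (x, t) → (ζ r : E × ℝ →L[ℝ] ℝ)
      ((mfderiv (𝓘(ℝ, E).prod 𝓘(ℝ, ℝ)) (𝓘(ℝ, E).prod 𝓘(ℝ, ℝ)) (mk φ) (φ x, t + 1) :
        E × ℝ →L[ℝ] E × ℝ) ((mfderiv 𝓘(ℝ, E) 𝓘(ℝ, E) φ x : E →L[ℝ] E) u, s)) =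
      lift ζ (x, t) (u, s) := by
    rintro r rfl
    exact congrArg (fun l : E × ℝ →L[ℝ] E × ℝ => (ζ (mk φ (x, t)) : E × ℝ →L[ℝ] ℝ) (l (u, s)))
      h5.symm
  exact h6 _ (mk_apply_add_one φ x t)

variable (φ) in
/-- The local parametrization of the mapping torus by `E × ℝ` that comes from a chart of `L`. -/
def param (x : L) (y : E × ℝ) : MappingTorus φ :=
  mk φ ((extChartAt 𝓘(ℝ, E) x).symm y.1, y.2)

theorem contMDiffAt_param [IsManifold 𝓘(ℝ, E) ∞ L] (x : L) {y : E × ℝ}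
    (hy : y.1 ∈ (extChartAt 𝓘(ℝ, E) x).target) :
    ContMDiffAt 𝓘(ℝ, E × ℝ) (𝓘(ℝ, E).prod 𝓘(ℝ, ℝ)) ∞ (param φ x) y := by
  have h1 : ContMDiffAt 𝓘(ℝ, E) 𝓘(ℝ, E) ∞ (extChartAt 𝓘(ℝ, E) x).symm y.1 :=
    (contMDiffOn_extChartAt_symm x).contMDiffAt ((isOpen_extChartAt_target x).mem_nhds hy)
  have h2 : ContMDiffAt 𝓘(ℝ, E × ℝ) 𝓘(ℝ, E) ∞ (fun y : E × ℝ => y.1) y :=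
    contDiff_fst.contMDiff y
  have h3 : ContMDiffAt 𝓘(ℝ, E × ℝ) 𝓘(ℝ, ℝ) ∞ (fun y : E × ℝ => y.2) y :=
    contDiff_snd.contMDiff y
  exact (contMDiff_mk φ _).comp y ((h1.comp y h2).prodMk h3)

theorem onSpace_param_apply [IsManifold 𝓘(ℝ, E) ∞ L]
    (ζ : OneForm (𝓘(ℝ, E).prod 𝓘(ℝ, ℝ)) (MappingTorus φ)) (x : L) {y : E × ℝ}
    (hy : y.1 ∈ (extChartAt 𝓘(ℝ, E) x).target) (u : E) (s : ℝ) :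
    ζ.onSpace (param φ x) y (u, s) = lift ζ ((extChartAt 𝓘(ℝ, E) x).symm y.1, y.2)
      ((mfderiv 𝓘(ℝ, E) 𝓘(ℝ, E) (extChartAt 𝓘(ℝ, E) x).symm y.1 : E →L[ℝ] E) u, s) := by
  have h1 : HasMFDerivAt 𝓘(ℝ, E) 𝓘(ℝ, E) (extChartAt 𝓘(ℝ, E) x).symm y.1
      (mfderiv 𝓘(ℝ, E) 𝓘(ℝ, E) (extChartAt 𝓘(ℝ, E) x).symm y.1) :=
    (((contMDiffOn_extChartAt_symm (n := 1) x).contMDiffAt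
      ((isOpen_extChartAt_target x).mem_nhds hy)).mdifferentiableAt (by simp)).hasMFDerivAt
  have h2 := (HasMFDerivAt.comp (I := 𝓘(ℝ, E × ℝ)) y h1
    (hasFDerivAt_fst (p := y)).hasMFDerivAt).prodMk
    (hasFDerivAt_snd (p := y)).hasMFDerivAt
  have h4 : HasMFDerivAt (𝓘(ℝ, E).prod 𝓘(ℝ, ℝ)) (𝓘(ℝ, E).prod 𝓘(ℝ, ℝ)) (mk φ)
      ((extChartAt 𝓘(ℝ, E) x).symm y.1, y.2) _ :=
    ((contMDiff_mk φ).mdifferentiable (by simp) _).hasMFDerivAt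
  exact congrArg (fun l : E × ℝ →L[ℝ] E × ℝ => (ζ (param φ x y) : E × ℝ →L[ℝ] ℝ) (l (u, s)))
    (h4.comp y h2).mfderiv

end MappingTorus

/-! ### Periodic functions as functions on the circle. -/

section Circle

/-- A smooth `1`-periodic function descends to the circle. -/
theorem exists_contMDiffMap_circle {F : ℝ → ℝ} (hF : ContDiff ℝ ∞ F) (hper : F.Periodic 1) :
    ∃ f : C^∞⟮𝓡 1, Circle; 𝓘(ℝ, ℝ), ℝ⟯, ∀ t, f (Circle.exp (2 * Real.pi * t)) = F t := by
  have hpi : 2 * Real.pi ≠ 0 := by positivity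
  have key : ∀ θ η : ℝ, Circle.exp θ = Circle.exp η →
      F (θ / (2 * Real.pi)) = F (η / (2 * Real.pi)) := by
    intro θ η h
    obtain ⟨m, hm⟩ := Circle.exp_eq_exp.1 h
    rw [hm, add_div, mul_div_assoc, div_self hpi, mul_one]
    simpa using hper.int_mul m (η / (2 * Real.pi))
  have harg : ∀ z : Circle, Circle.exp (Complex.arg z) = z := fun z => Circle.exp_arg z
  have : Fact (Module.finrank ℝ ℂ = 1 + 1) := finrank_real_complex_fact'
  have hcoe : ContMDiff (𝓡 1) 𝓘(ℝ, ℂ) ∞ (fun z : Circle => (z : ℂ)) := contMDiff_coe_sphere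
  have hlog : ∀ w : ℂ, w ∈ Complex.slitPlane → ContDiffAt ℝ ∞ Complex.arg w := by
    intro w hw
    have h1 : ContDiffAt ℝ ∞ Complex.log w := (Complex.contDiffAt_log hw).restrict_scalars ℝ
    exact (Complex.imCLM.contDiff.contDiffAt.comp w h1).congr_of_eventuallyEq
      (Filter.Eventually.of_forall fun z => (Complex.log_im z).symm)
  refine ⟨⟨fun z => F (Complex.arg z / (2 * Real.pi)), fun z => ?_⟩, fun t => ?_⟩
  -- The principal argument is smooth away from its cut. On the cut the branch π + arg(-z) is
  -- smooth, and by periodicity `F` gives the same value on both branches.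
  · by_cases hz : (z : ℂ) ∈ Complex.slitPlane
    · have h1 : ContDiffAt ℝ ∞ (fun w : ℂ => F (Complex.arg w / (2 * Real.pi))) (z : ℂ) :=
        hF.contDiffAt.comp (z : ℂ) ((hlog _ hz).div_const _)
      exact h1.contMDiffAt.comp z (hcoe z)
    · have hz' : -(z : ℂ) ∈ Complex.slitPlane := by
        rw [Complex.mem_slitPlane_iff] at hz ⊢
        push Not at hz
        refine Or.inl ?_
        rw [Complex.neg_re, neg_pos]
        refine lt_of_le_of_ne hz.1 fun h0 => Circle.coe_ne_zero z (Complex.ext h0 hz.2)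
      have h1 : ContDiffAt ℝ ∞
          (fun w : ℂ => F ((Real.pi + Complex.arg (-w)) / (2 * Real.pi))) (z : ℂ) :=
        hF.contDiffAt.comp (z : ℂ) ((contDiffAt_const.add
          ((hlog _ hz').comp (z : ℂ) contDiffAt_id.neg)).div_const _)
      refine (h1.contMDiffAt.comp z (hcoe z)).congr_of_eventuallyEq
        (Filter.Eventually.of_forall fun w => key _ _ ?_)
      have h2 := harg (-w)
      rw [harg, Circle.exp_add]
      rw [Circle.coe_neg] at h2
      rw [h2]
      ext
      simp
  · change F (Complex.arg (Circle.exp (2 * Real.pi * t)) / (2 * Real.pi)) = F t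
    rw [key _ _ (harg _), mul_div_cancel_left₀ _ hpi]

end Circle

/-! ### The ordinary differential equations for the coefficients. -/

section Calculus

theorem exists_contDiff_primitive {D : ℝ → ℝ} (hD : ContDiff ℝ ∞ D) :
    ∃ P : ℝ → ℝ, ContDiff ℝ ∞ P ∧ (∀ t, HasDerivAt P (D t) t) ∧ P 0 = 0 := by
  have h1 : ∀ t, HasDerivAt (fun t => ∫ s in (0 : ℝ)..t, D s) (D t) t := fun t =>
    intervalIntegral.integral_hasDerivAt_right (hD.continuous.intervalIntegrable _ _)
      (hD.continuous.stronglyMeasurableAtFilter _ _) hD.continuous.continuousAt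
  refine ⟨_, contDiff_infty_iff_deriv.2 ⟨fun t => (h1 t).differentiableAt, ?_⟩, h1, by simp⟩
  rwa [funext fun t => (h1 t).deriv]

theorem eq_of_hasDerivAt_zero {f : ℝ → ℝ} (hf : ∀ t, HasDerivAt f 0 t) (s t : ℝ) : f s = f t :=
  is_const_of_deriv_eq_zero (fun t => (hf t).differentiableAt) (fun t => (hf t).deriv) s t

/-- The coefficients of `ζ₂ = D dt` and `ζ₁ = A α + B dt`, in terms of periodic functions. -/
theorem exists_periodic_normal_form {lam : ℝ} (hlam : lam ≠ 0) {A B D : ℝ → ℝ}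
    (hB : ContDiff ℝ ∞ B) (hD : ContDiff ℝ ∞ D) (hA' : ∀ t, HasDerivAt A (D t * A t) t)
    (hA1 : ∀ t, A (t + 1) * Real.exp lam = A t) (hB1 : B.Periodic 1)
    {t₀ : ℝ} (hA0 : A t₀ ≠ 0) :
    ∃ (F G : ℝ → ℝ) (K : ℝ), ContDiff ℝ ∞ F ∧ ContDiff ℝ ∞ G ∧ F.Periodic 1 ∧ G.Periodic 1 ∧
      K ≠ 0 ∧ (∀ t, D t = -lam + deriv F t) ∧
      (∀ t, A t = Real.exp (F t) * (K * Real.exp (-lam * t))) ∧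
      ∀ t, B t = Real.exp (F t) * (deriv G t + G t * lam) := by
  obtain ⟨P, hP, hP', hP0⟩ := exists_contDiff_primitive hD
  have hAP : ∀ t, A t = A 0 * Real.exp (P t) := fun t => by
    -- Integrating factor for A' = D A.
    have h1 : ∀ t, HasDerivAt (fun t => A t * Real.exp (-P t)) 0 t := fun t => by
      have h2 := (hA' t).mul (hP' t).neg.exp
      refine h2.congr_deriv ?_
      ring
    have h3 := eq_of_hasDerivAt_zero h1 t 0
    simp only [hP0, neg_zero, Real.exp_zero, mul_one] at h3
    rw [← h3, mul_assoc, ← Real.exp_add]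
    simp
  have hK : A 0 ≠ 0 := fun h => hA0 (by rw [hAP, h, zero_mul])
  have hPper : ∀ t, P (t + 1) + lam = P t := fun t => by
    have h1 := hA1 t
    rw [hAP (t + 1), hAP t, mul_assoc, ← Real.exp_add] at h1
    exact Real.exp_injective (mul_left_cancel₀ hK h1)
  have hF' : ∀ t, HasDerivAt (fun t => P t + lam * t) (D t + lam) t := fun t => by
    have h1 := (hP' t).add ((hasDerivAt_id t).const_mul lam)
    rwa [mul_one] at h1
  have hF : ContDiff ℝ ∞ (fun t => P t + lam * t) := hP.add (contDiff_const.mul contDiff_id)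
  have hF1 : Function.Periodic (fun t => P t + lam * t) 1 := fun t => by
    change P (t + 1) + lam * (t + 1) = P t + lam * t
    rw [← hPper t]
    ring
  set F : ℝ → ℝ := fun t => P t + lam * t with hF_def
  -- The equation B = e^F (G' + λG) is equivalent to (e^{λt} G)' = b, so G = e^{-λt}(c + Q) with Q a
  -- primitive of b.
  set b : ℝ → ℝ := fun t => Real.exp (lam * t) * (Real.exp (-F t) * B t) with hb_def
  have hb : ContDiff ℝ ∞ b :=
    (contDiff_const.mul contDiff_id).exp.mul (hF.neg.exp.mul hB)
  have hb1 : ∀ t, b (t + 1) = Real.exp lam * b t := fun t => by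
    simp only [hb_def, hF1 t, hB1 t, mul_add, Real.exp_add, mul_one]
    ring
  obtain ⟨Q, hQ, hQ', hQ0⟩ := exists_contDiff_primitive hb
  have hexp : Real.exp lam - 1 ≠ 0 := by
    rw [sub_ne_zero, Ne, Real.exp_eq_one_iff]
    exact hlam
  -- The integration constant that makes G periodic: since Q(t + 1) = Q(1) + e^λ Q(t), periodicity
  -- requires c e^λ = c + Q(1).
  set c : ℝ := Q 1 / (Real.exp lam - 1) with hc
  have hQ1 : ∀ t, Q (t + 1) = Q 1 + Real.exp lam * Q t := fun t => by
    have h1 : ∀ t, HasDerivAt (fun t => Q (t + 1) - Real.exp lam * Q t) 0 t := fun t => by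
      have h2 := ((hQ' (t + 1)).comp_add_const t 1).sub ((hQ' t).const_mul (Real.exp lam))
      rwa [hb1, sub_self] at h2
    have h3 := eq_of_hasDerivAt_zero h1 t 0
    simp only [zero_add, hQ0, mul_zero, sub_zero] at h3
    linarith
  have hcQ : c * Real.exp lam = c + Q 1 := by
    rw [hc]
    field_simp
    ring
  have hG' : ∀ t, HasDerivAt (fun t => Real.exp (-lam * t) * (c + Q t))
      (Real.exp (-lam * t) * (-lam) * (c + Q t) + Real.exp (-lam * t) * b t) t := fun t => by
    have h1 : HasDerivAt (fun t => -lam * t) (-lam) t := by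
      simpa using (hasDerivAt_id t).const_mul (-lam)
    exact h1.exp.mul ((hQ' t).const_add c)
  refine ⟨F, fun t => Real.exp (-lam * t) * (c + Q t), A 0, hF,
    (contDiff_const.mul contDiff_id).exp.mul (contDiff_const.add hQ), hF1, fun t => ?_, hK,
    fun t => ?_, fun t => ?_, fun t => ?_⟩
  · change Real.exp (-lam * (t + 1)) * (c + Q (t + 1)) = Real.exp (-lam * t) * (c + Q t)
    rw [hQ1, ← add_assoc, ← hcQ, mul_add (-lam), Real.exp_add, mul_comm c, ← mul_add, mul_one,
      Real.exp_neg lam]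
    field_simp
  · rw [(hF' t).deriv]
    ring
  · rw [hAP t, hF_def]
    simp only [Real.exp_add, neg_mul, Real.exp_neg]
    field_simp
  · rw [(hG' t).deriv, hb_def]
    simp only [neg_mul, Real.exp_neg]
    field_simp
    ring

end Calculus

/-! ### From local to global oscillation bounds. -/

section Oscillation

/-- On a compact connected space, locally uniform bounds on the oscillation of a family of functions
add up to a global one. -/
theorem exists_oscillation_bound {X ι : Type*} [TopologicalSpace X] [CompactSpace X]
    [ConnectedSpace X] (f : ι → X → ℝ) (κ : ι → ℝ) (hκ : ∀ i, 0 ≤ κ i)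
    (h : ∀ x, ∃ C, ∀ᶠ y in 𝓝 x, ∀ i, |f i y - f i x| ≤ C * κ i) :
    ∃ C, ∀ i x y, |f i x - f i y| ≤ C * κ i := by
  obtain ⟨x₁⟩ := (inferInstance : Nonempty X)
  -- The local hypothesis makes `S` both open and closed, hence everything by connectedness. The
  -- constant still depends on the point; compactness then makes it uniform.
  set S : Set X := {x | ∃ C, ∀ i, |f i x - f i x₁| ≤ C * κ i} with hS
  have hopen : IsOpen S := isOpen_iff_mem_nhds.2 fun x ⟨C, hC⟩ => by
    obtain ⟨C', hC'⟩ := h x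
    filter_upwards [hC'] with y hy
    refine ⟨C' + C, fun i => ?_⟩
    rw [add_mul]
    exact (abs_sub_le _ (f i x) _).trans (add_le_add (hy i) (hC i))
  have hclosed : IsClosed S := ⟨isOpen_iff_mem_nhds.2 fun x hx => by
    obtain ⟨C', hC'⟩ := h x
    filter_upwards [hC'] with y hy
    rintro ⟨C, hC⟩
    refine hx ⟨C' + C, fun i => ?_⟩
    rw [add_mul]
    have h1 := hy i
    rw [abs_sub_comm] at h1
    exact (abs_sub_le _ (f i y) _).trans (add_le_add h1 (hC i))⟩
  have huniv : S = univ := IsClopen.eq_univ ⟨hclosed, hopen⟩ ⟨x₁, 0, fun i => by simp⟩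
  obtain ⟨C, hC⟩ : ∃ C, ∀ y ∈ (univ : Set X), ∀ i, |f i y - f i x₁| ≤ C * κ i := by
    refine isCompact_univ.induction_on (p := fun s => ∃ C, ∀ y ∈ s, ∀ i, |f i y - f i x₁| ≤ C * κ i)
      ⟨0, by simp⟩ (fun s t hst ⟨C, hC⟩ => ⟨C, fun y hy => hC y (hst hy)⟩) ?_ fun x _ => ?_
    · rintro s t ⟨C, hC⟩ ⟨C', hC'⟩
      refine ⟨max C C', ?_⟩
      rintro y (hy | hy) i
      · exact (hC y hy i).trans (mul_le_mul_of_nonneg_right (le_max_left _ _) (hκ i))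
      · exact (hC' y hy i).trans (mul_le_mul_of_nonneg_right (le_max_right _ _) (hκ i))
    · obtain ⟨C, hC⟩ : x ∈ S := huniv ▸ mem_univ x
      obtain ⟨C', hC'⟩ := h x
      refine ⟨_, mem_nhdsWithin_of_mem_nhds hC', C' + C, fun y hy i => ?_⟩
      rw [add_mul]
      exact (abs_sub_le _ (f i x) _).trans (add_le_add (hy i) (hC i))
  refine ⟨C + C, fun i x y => ?_⟩
  rw [add_mul]
  have h1 := hC y (mem_univ y) i
  rw [abs_sub_comm] at h1
  exact (abs_sub_le _ (f i x₁) _).trans (add_le_add (hC x (mem_univ x) i) h1)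

end Oscillation

/-! ### Functions constant along the leaves of ker α are constant. -/

section BasicFunctions

variable {E L : Type*} [NormedAddCommGroup E] [NormedSpace ℝ E]
  [TopologicalSpace L] [ChartedSpace E L] [IsManifold 𝓘(ℝ, E) ∞ L]

theorem contMDiffAt_extChartAt_symm_of_mem {x : L} {y : E}
    (hy : y ∈ (extChartAt 𝓘(ℝ, E) x).target) :
    ContMDiffAt 𝓘(ℝ, E) 𝓘(ℝ, E) ∞ (extChartAt 𝓘(ℝ, E) x).symm y :=
  (contMDiffOn_extChartAt_symm x).contMDiffAt ((isOpen_extChartAt_target x).mem_nhds hy)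

/-- The tangent space at `x` is identified with `E` through the preferred chart at `x`, so the
inverse chart has identity derivative at the base point. -/
theorem OneForm.onSpace_chart_self (β : OneForm 𝓘(ℝ, E) L) (x : L) (u : E) :
    β.onSpace (extChartAt 𝓘(ℝ, E) x).symm (extChartAt 𝓘(ℝ, E) x x) u = β x u := by
  have h1 : mfderiv 𝓘(ℝ, E) 𝓘(ℝ, E) (extChartAt 𝓘(ℝ, E) x).symm (extChartAt 𝓘(ℝ, E) x x) =
      ContinuousLinearMap.id ℝ E := by
    refine ((contMDiffAt_extChartAt_symm_of_mem
      (mem_extChartAt_target x)).mdifferentiableAt (by simp)).mfderiv.trans ?_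
    have h2 : writtenInExtChartAt 𝓘(ℝ, E) 𝓘(ℝ, E) (extChartAt 𝓘(ℝ, E) x x)
        (extChartAt 𝓘(ℝ, E) x).symm =ᶠ[𝓝 (extChartAt 𝓘(ℝ, E) x x)] id := by
      filter_upwards [extChartAt_target_mem_nhds (I := 𝓘(ℝ, E)) x] with y hy
      rw [writtenInExtChartAt, extChartAt_to_inv]
      exact (extChartAt 𝓘(ℝ, E) x).right_inv hy
    rw [ModelWithCorners.range_eq_univ, fderivWithin_univ]
    exact h2.fderiv_eq.trans fderiv_id
  have h3 : ∀ r, r = x → (β r : E →L[ℝ] ℝ)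
      ((mfderiv 𝓘(ℝ, E) 𝓘(ℝ, E) (extChartAt 𝓘(ℝ, E) x).symm (extChartAt 𝓘(ℝ, E) x x) :
        E →L[ℝ] E) u) = β x u := by
    rintro r rfl
    rw [h1]
    rfl
  exact h3 _ (extChartAt_to_inv x)

theorem hasFDerivAt_comp_chart {h : L → ℝ} {x : L} {y : E}
    (hy : y ∈ (extChartAt 𝓘(ℝ, E) x).target)
    (hh : MDifferentiable 𝓘(ℝ, E) 𝓘(ℝ, ℝ) h) :
    HasFDerivAt (h ∘ (extChartAt 𝓘(ℝ, E) x).symm)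
      ((OneForm.differential 𝓘(ℝ, E) h).onSpace (extChartAt 𝓘(ℝ, E) x).symm y) y := by
  have h1 := (hh _).hasMFDerivAt.comp y
    ((contMDiffAt_extChartAt_symm_of_mem hy).mdifferentiableAt (by simp)).hasMFDerivAt
  exact h1.hasFDerivAt

/-- The oscillation of a function on a compact connected manifold is bounded by the size of its
differential relative to a fixed smooth one-form. -/
theorem exists_oscillation_bound_of_differential [CompactSpace L] [ConnectedSpace L]
    {α : OneForm 𝓘(ℝ, E) L} (hα : α.IsSmooth) :
    ∃ C, ∀ (h : L → ℝ) (κ : ℝ), MDifferentiable 𝓘(ℝ, E) 𝓘(ℝ, ℝ) h → 0 ≤ κ →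
      (∀ x u, |OneForm.differential 𝓘(ℝ, E) h x u| ≤ κ * |α x u|) →
      ∀ x y, |h x - h y| ≤ C * κ := by
  -- All admissible pairs (h, κ) are indexed at once, so that the resulting constant depends on α
  -- alone.
  let ι := {p : (L → ℝ) × ℝ // MDifferentiable 𝓘(ℝ, E) 𝓘(ℝ, ℝ) p.1 ∧ 0 ≤ p.2 ∧
    ∀ x u, |OneForm.differential 𝓘(ℝ, E) p.1 x u| ≤ p.2 * |α x u|}
  obtain ⟨C, hC⟩ := exists_oscillation_bound (fun i : ι => i.1.1) (fun i : ι => i.1.2)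
    (fun i => i.2.2.1) fun x => by
    set c := extChartAt 𝓘(ℝ, E) x with hc
    have ha : ContDiffAt ℝ ∞ (α.onSpace c.symm) (c x) :=
      hα.contDiffAt_pullback (contMDiffAt_extChartAt_symm_of_mem (mem_extChartAt_target x))
    obtain ⟨N, hN⟩ : ∃ N, ∀ᶠ y in 𝓝 (c x), ‖α.onSpace c.symm y‖ ≤ N :=
      ⟨‖α.onSpace c.symm (c x)‖ + 1, (ha.continuousAt.norm.eventually
        (gt_mem_nhds (lt_add_one _))).mono fun y hy => hy.le⟩
    obtain ⟨r, hr, hball⟩ := Metric.eventually_nhds_iff_ball.1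
      (hN.and (extChartAt_target_mem_nhds (I := 𝓘(ℝ, E)) x))
    -- Mean value inequality on a chart ball of radius `r`, where α has norm at most `N` and hence
    -- dh at most `κ * N`.
    refine ⟨N * r, ?_⟩
    filter_upwards [extChartAt_source_mem_nhds (I := 𝓘(ℝ, E)) x,
      (continuousAt_extChartAt (I := 𝓘(ℝ, E)) x).eventually (Metric.ball_mem_nhds _ hr)]
      with y hys hy i
    obtain ⟨⟨h, κ⟩, hh, hκ, hb⟩ := i
    have h1 : ∀ z ∈ Metric.ball (c x) r, ‖(OneForm.differential 𝓘(ℝ, E) h).onSpace c.symm z‖ ≤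
        κ * N := fun z hz => by
      have hN0 : 0 ≤ N := (norm_nonneg _).trans (hball z hz).1
      refine ContinuousLinearMap.opNorm_le_bound _ (mul_nonneg hκ hN0) fun u => ?_
      refine (hb _ _).trans ?_
      rw [mul_assoc]
      exact mul_le_mul_of_nonneg_left ((α.onSpace c.symm z).le_of_opNorm_le (hball z hz).1 u) hκ
    have h2 := (convex_ball (c x) r).norm_image_sub_le_of_norm_hasFDerivWithin_le
      (fun z hz => (hasFDerivAt_comp_chart (hball z hz).2 hh).hasFDerivWithinAt) h1
      (Metric.mem_ball_self hr) hy
    simp only [Function.comp_apply] at h2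
    rw [(extChartAt 𝓘(ℝ, E) x).left_inv hys, extChartAt_to_inv] at h2
    have h3 : ‖c y - c x‖ ≤ r := by
      rw [← dist_eq_norm]
      exact (Metric.mem_ball.1 hy).le
    calc |h y - h x| ≤ κ * N * ‖c y - c x‖ := h2
      _ ≤ κ * N * r := mul_le_mul_of_nonneg_left h3
        ((norm_nonneg _).trans (h1 _ (Metric.mem_ball_self hr)))
      _ = N * r * κ := by ring
  exact ⟨C, fun h κ hh hκ hb x y => hC ⟨(h, κ), hh, hκ, hb⟩ x y⟩

/-- A smooth function whose differential is a multiple of the nowhere-vanishing one-form `α` on a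
compact manifold has differential bounded by a constant multiple of `α`. -/
theorem exists_differential_le [CompactSpace L]
    {α : OneForm 𝓘(ℝ, E) L} (hα : α.IsSmooth) (hα_ne : ∀ x, α x ≠ 0) {h : L → ℝ}
    (hh : ContMDiff 𝓘(ℝ, E) 𝓘(ℝ, ℝ) ∞ h)
    (hb : ∀ x u u', OneForm.differential 𝓘(ℝ, E) h x u * α x u' =
      OneForm.differential 𝓘(ℝ, E) h x u' * α x u) :
    ∃ κ, 0 ≤ κ ∧ ∀ x u, |OneForm.differential 𝓘(ℝ, E) h x u| ≤ κ * |α x u| := by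
  have hv : ∀ x, ∃ v : E, α x v ≠ 0 := fun x => by
    by_contra! hx
    exact hα_ne x (ContinuousLinearMap.ext hx)
  obtain ⟨v, hv⟩ := Classical.skolem.1 hv
  set k : L → ℝ := fun x => OneForm.differential 𝓘(ℝ, E) h x (v x) / α x (v x) with hk
  have hk' : ∀ x u, OneForm.differential 𝓘(ℝ, E) h x u = k x * α x u := fun x u => by
    rw [hk, div_mul_eq_mul_div, eq_div_iff (hv x)]
    exact hb x u (v x)
  -- The choice `v` need not be continuous. Near `x` the frozen vector `v x` stays outside ker α in
  -- the chart, and the quotient dh/α evaluated on it is still `k`.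
  have hcont : Continuous k := continuous_iff_continuousAt.2 fun x => by
    set c := extChartAt 𝓘(ℝ, E) x with hc
    have hx := mem_extChartAt_target (I := 𝓘(ℝ, E)) x
    have ha : ContinuousAt (fun y => α.onSpace c.symm y (v x)) (c x) :=
      (hα.contDiffAt_pullback (contMDiffAt_extChartAt_symm_of_mem hx)).continuousAt.clm_apply
        continuousAt_const
    have ha0 : α.onSpace c.symm (c x) (v x) ≠ 0 := by
      exact (α.onSpace_chart_self x (v x)).trans_ne (hv x)
    have hd : ContDiffAt ℝ ∞ (h ∘ c.symm) (c x) :=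
      (hh.contMDiffAt.comp (c x) (contMDiffAt_extChartAt_symm_of_mem hx)).contDiffAt
    have hd' : ContinuousAt (fun y => fderiv ℝ (h ∘ c.symm) y (v x)) (c x) :=
      (hd.fderiv_right (m := 0) (by simp)).continuousAt.clm_apply continuousAt_const
    have hq := (hd'.div ha ha0).comp_of_eq (continuousAt_extChartAt (I := 𝓘(ℝ, E)) x) rfl
    refine hq.congr ?_
    have ha1 := (continuousAt_extChartAt (I := 𝓘(ℝ, E)) x).eventually (ha.eventually_ne ha0)
    filter_upwards [ha1, extChartAt_source_mem_nhds (I := 𝓘(ℝ, E)) x] with y hy hys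
    have h1 := (hasFDerivAt_comp_chart (c.map_source hys) (hh.mdifferentiable (by simp))).fderiv
    change fderiv ℝ (h ∘ c.symm) (c y) (v x) / α.onSpace c.symm (c y) (v x) = k y
    rw [h1, div_eq_iff hy]
    exact (hk' _ _).trans (congrArg (fun z => k z * α.onSpace c.symm (c y) (v x))
      ((extChartAt 𝓘(ℝ, E) x).left_inv hys))
  obtain ⟨κ, hκ⟩ := (isCompact_range hcont).isBounded.exists_norm_le
  refine ⟨max κ 0, le_max_right _ _, fun x u => ?_⟩
  rw [hk', abs_mul]
  exact mul_le_mul_of_nonneg_right ((hκ _ ⟨x, rfl⟩).trans (le_max_left _ _)) (abs_nonneg _)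

/-- Each composition with `ψ` multiplies the bound on the differential by `a`, so the oscillation of
`h ∘ ψ^[n]` tends to zero; surjectivity of `ψ^[n]` makes it equal to that of `h`. -/
theorem eq_of_differential_le_of_contraction [CompactSpace L] [ConnectedSpace L]
    (ψ : L ≃ₘ⟮𝓘(ℝ, E), 𝓘(ℝ, E)⟯ L) {α : OneForm 𝓘(ℝ, E) L} (hα : α.IsSmooth)
    {a : ℝ} (ha : 0 ≤ a) (ha1 : a < 1)
    (hψ : ∀ x u, |OneForm.pullback (J := 𝓘(ℝ, E)) ψ α x u| = a * |α x u|)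
    {h : L → ℝ} (hh : ContMDiff 𝓘(ℝ, E) 𝓘(ℝ, ℝ) ∞ h) {κ : ℝ} (hκ : 0 ≤ κ)
    (hb : ∀ x u, |OneForm.differential 𝓘(ℝ, E) h x u| ≤ κ * |α x u|) (x y : L) : h x = h y := by
  obtain ⟨C, hC⟩ := exists_oscillation_bound_of_differential hα
  have hstep : ∀ n : ℕ, ContMDiff 𝓘(ℝ, E) 𝓘(ℝ, ℝ) ∞ (h ∘ ψ^[n]) ∧
      ∀ x u, |OneForm.differential 𝓘(ℝ, E) (h ∘ ψ^[n]) x u| ≤ κ * a ^ n * |α x u| := by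
    intro n
    induction n with
    | zero => simpa using ⟨hh, hb⟩
    | succ n ih =>
      have hn : h ∘ ψ^[n + 1] = (h ∘ ψ^[n]) ∘ ψ := by
        rw [Function.iterate_succ]; rfl
      rw [hn]
      refine ⟨ih.1.comp ψ.contMDiff, fun x u => ?_⟩
      have h1 : OneForm.differential 𝓘(ℝ, E) ((h ∘ ψ^[n]) ∘ ψ) x u =
          OneForm.differential 𝓘(ℝ, E) (h ∘ ψ^[n]) (ψ x) (mfderiv 𝓘(ℝ, E) 𝓘(ℝ, E) ψ x u) :=
        congrArg (fun l => l u) (mfderiv_comp x (ih.1.mdifferentiable (by simp) _)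
          (ψ.contMDiff.mdifferentiable (by simp) x))
      rw [h1]
      refine (ih.2 _ _).trans (le_of_eq ?_)
      rw [pow_succ, ← mul_assoc, mul_assoc _ a, ← hψ]
      rfl
  have hbound : ∀ n : ℕ, |h x - h y| ≤ C * (κ * a ^ n) := fun n => by
    obtain ⟨x', rfl⟩ := ψ.surjective.iterate n x
    obtain ⟨y', rfl⟩ := ψ.surjective.iterate n y
    exact hC _ _ ((hstep n).1.mdifferentiable (by simp)) (mul_nonneg hκ (pow_nonneg ha n))
      (hstep n).2 x' y'
  have hlim : Filter.Tendsto (fun n : ℕ => C * (κ * a ^ n)) Filter.atTop (𝓝 (C * (κ * 0))) :=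
    ((tendsto_pow_atTop_nhds_zero_of_lt_one ha ha1).const_mul κ).const_mul C
  have h0 : |h x - h y| ≤ C * (κ * 0) := ge_of_tendsto' hlim hbound
  rw [mul_zero, mul_zero] at h0
  exact sub_eq_zero.1 (abs_eq_zero.1 (le_antisymm h0 (abs_nonneg _)))

/-- If `φ^* α = e^λ α` with `λ ≠ 0`, the functions that are constant along the leaves of `ker α` are
constant: composing with iterates of `φ` or its inverse makes the differential small, but keeps the
oscillation. -/
theorem eq_of_basic [CompactSpace L] [ConnectedSpace L]
    (φ : L ≃ₘ⟮𝓘(ℝ, E), 𝓘(ℝ, E)⟯ L) {α : OneForm 𝓘(ℝ, E) L} (hα : α.IsSmooth)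
    (hα_ne : ∀ x, α x ≠ 0) {lam : ℝ} (hlam : lam ≠ 0)
    (hφα : OneForm.pullback (J := 𝓘(ℝ, E)) φ α = fun x => Real.exp lam • α x)
    {h : L → ℝ} (hh : ContMDiff 𝓘(ℝ, E) 𝓘(ℝ, ℝ) ∞ h)
    (hb : ∀ x u u', OneForm.differential 𝓘(ℝ, E) h x u * α x u' =
      OneForm.differential 𝓘(ℝ, E) h x u' * α x u) (x y : L) : h x = h y := by
  obtain ⟨κ, hκ, hκb⟩ := exists_differential_le hα hα_ne hh hb
  -- For λ < 0 the map φ contracts α; for λ > 0 its inverse does.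
  rcases lt_or_gt_of_ne hlam with hl | hl
  · refine eq_of_differential_le_of_contraction φ hα (Real.exp_pos lam).le
      (Real.exp_lt_one_iff.2 hl) (fun x u => ?_) hh hκ hκb x y
    rw [hφα]
    change |Real.exp lam * α x u| = _
    rw [abs_mul, abs_of_pos (Real.exp_pos lam)]
  · refine eq_of_differential_le_of_contraction φ.symm hα (Real.exp_pos (-lam)).le
      (Real.exp_lt_one_iff.2 (neg_lt_zero.2 hl)) (fun x u => ?_) hh hκ hκb x y
    have h1 : OneForm.pullback (J := 𝓘(ℝ, E)) φ.symm (OneForm.pullback (J := 𝓘(ℝ, E)) φ α) = α := by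
      rw [OneForm.pullback_pullback _ _ _ (φ.contMDiff.mdifferentiable (by simp))
        (φ.symm.contMDiff.mdifferentiable (by simp))]
      have h2 : (φ ∘ φ.symm : L → L) = id := funext φ.apply_symm_apply
      rw [h2]
      exact OneForm.pullback_id α
    rw [hφα] at h1
    have h3 : Real.exp lam * OneForm.pullback (J := 𝓘(ℝ, E)) φ.symm α x u = α x u :=
      congrArg (fun β : OneForm 𝓘(ℝ, E) L => β x u) h1
    rw [← h3, abs_mul, abs_of_pos (Real.exp_pos lam), ← mul_assoc, ← Real.exp_add]
    simp

end BasicFunctions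

/-! ### Smooth functions of (x, t) and their partial derivatives. -/

section JointlySmooth

variable {E L : Type*} [NormedAddCommGroup E] [NormedSpace ℝ E]
  [TopologicalSpace L] [ChartedSpace E L]

variable (E) in
/-- The function `(x, t) ↦ P x t` is smooth, expressed in the charts of `L`. -/
def JointlySmooth (P : L → ℝ → ℝ) : Prop :=
  ∀ x t, ContDiffAt ℝ ∞ (fun y : E × ℝ => P ((extChartAt 𝓘(ℝ, E) x).symm y.1) y.2)
    (extChartAt 𝓘(ℝ, E) x x, t)

theorem JointlySmooth.contDiff {P : L → ℝ → ℝ} (hP : JointlySmooth E P) (x : L) :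
    ContDiff ℝ ∞ (P x) := contDiff_iff_contDiffAt.2 fun t => by
  have h1 := (hP x t).comp t (contDiffAt_const.prodMk contDiffAt_id)
  simp only [Function.comp_def, extChartAt_to_inv] at h1
  exact h1

theorem JointlySmooth.contMDiff [IsManifold 𝓘(ℝ, E) ∞ L] {P : L → ℝ → ℝ}
    (hP : JointlySmooth E P) (t : ℝ) :
    ContMDiff 𝓘(ℝ, E) 𝓘(ℝ, ℝ) ∞ (fun x => P x t) := fun x => by
  have h1 : ContDiffAt ℝ ∞ (fun y : E => P ((extChartAt 𝓘(ℝ, E) x).symm y) t)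
      (extChartAt 𝓘(ℝ, E) x x) :=
    ContDiffAt.comp (f := fun y : E => (y, t)) (extChartAt 𝓘(ℝ, E) x x) (hP x t)
      (contDiffAt_id.prodMk contDiffAt_const)
  have h2 := h1.contMDiffAt.comp x (contMDiffAt_extChartAt (I := 𝓘(ℝ, E)) (n := ∞) (x := x))
  refine h2.congr_of_eventuallyEq ?_
  filter_upwards [extChartAt_source_mem_nhds (I := 𝓘(ℝ, E)) x] with y hy
  simp only [Function.comp_apply]
  rw [(extChartAt 𝓘(ℝ, E) x).left_inv hy]

theorem JointlySmooth.fderiv_apply_left [IsManifold 𝓘(ℝ, E) ∞ L] {P : L → ℝ → ℝ}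
    (hP : JointlySmooth E P) (x : L) (t : ℝ) (u : E) :
    fderiv ℝ (fun y : E × ℝ => P ((extChartAt 𝓘(ℝ, E) x).symm y.1) y.2)
      (extChartAt 𝓘(ℝ, E) x x, t) (u, 0) =
      OneForm.differential 𝓘(ℝ, E) (fun x => P x t) x u := by
  have h1 := ((hP x t).differentiableAt (by simp)).hasFDerivAt.comp (extChartAt 𝓘(ℝ, E) x x)
    ((hasFDerivAt_id (𝕜 := ℝ) (extChartAt 𝓘(ℝ, E) x x)).prodMk (hasFDerivAt_const t _))
  have h2 := h1.unique (hasFDerivAt_comp_chart (mem_extChartAt_target x)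
    ((hP.contMDiff t).mdifferentiable (by simp)))
  exact (congrArg (fun l => l u) h2).trans (OneForm.onSpace_chart_self _ x u)

theorem JointlySmooth.fderiv_apply_right {P : L → ℝ → ℝ} (hP : JointlySmooth E P) (x : L) (t : ℝ) :
    fderiv ℝ (fun y : E × ℝ => P ((extChartAt 𝓘(ℝ, E) x).symm y.1) y.2)
      (extChartAt 𝓘(ℝ, E) x x, t) (0, 1) = deriv (P x) t := by
  have h1 := ((hP x t).differentiableAt (by simp)).hasFDerivAt.comp t
    ((hasFDerivAt_const (extChartAt 𝓘(ℝ, E) x x) t).prodMk (hasFDerivAt_id (𝕜 := ℝ) t))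
  simp only [Function.comp_def, extChartAt_to_inv] at h1
  exact h1.hasDerivAt.deriv.symm

end JointlySmooth

/-! ### Forms P α + Q dt on the cover and their exterior derivatives. -/

namespace MappingTorus

variable {E L : Type*} [NormedAddCommGroup E] [NormedSpace ℝ E]
  [TopologicalSpace L] [ChartedSpace E L] [IsManifold 𝓘(ℝ, E) ∞ L]
  [T2Space L] [LocallyCompactSpace L] {φ : L ≃ₘ⟮𝓘(ℝ, E), 𝓘(ℝ, E)⟯ L}

/-- The pullback of `ζ` to `L × ℝ` is `P α + Q dt`. -/
structure HasCoefficients (ζ : OneForm (𝓘(ℝ, E).prod 𝓘(ℝ, ℝ)) (MappingTorus φ))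
    (α : OneForm 𝓘(ℝ, E) L) (P Q : L → ℝ → ℝ) : Prop where
  left : JointlySmooth E P
  right : JointlySmooth E Q
  lift_eq : ∀ x t (u : E) s, lift ζ (x, t) (u, s) = P x t * α x u + Q x t * s

variable {ζ : OneForm (𝓘(ℝ, E).prod 𝓘(ℝ, ℝ)) (MappingTorus φ)} {α : OneForm 𝓘(ℝ, E) L}
  {P Q : L → ℝ → ℝ}

theorem onSpace_param_eq (h : ∀ x t (u : E) s, lift ζ (x, t) (u, s) = P x t * α x u + Q x t * s)
    (x : L) {y : E × ℝ} (hy : y.1 ∈ (extChartAt 𝓘(ℝ, E) x).target) (u : E) (s : ℝ) :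
    ζ.onSpace (param φ x) y (u, s) = P ((extChartAt 𝓘(ℝ, E) x).symm y.1) y.2 *
      α.onSpace (extChartAt 𝓘(ℝ, E) x).symm y.1 u + Q ((extChartAt 𝓘(ℝ, E) x).symm y.1) y.2 * s :=
  (onSpace_param_apply ζ x hy u s).trans (h _ _ _ _)

/-- A covector that vanishes on ker α_x × 0 is a combination of α_x and dt. The coefficient of α is
a quotient of values at a vector outside ker α; it is smooth near `x` because that vector may be
kept fixed in the chart. -/
theorem exists_hasCoefficients (hα : α.IsSmooth) (hα_ne : ∀ x, α x ≠ 0) (hζ : ζ.IsSmooth)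
    (h : ∀ x t (u : E), α x u = 0 → lift ζ (x, t) (u, 0) = 0) :
    ∃ P Q, HasCoefficients ζ α P Q := by
  have hv : ∀ x, ∃ v : E, α x v ≠ 0 := fun x => by
    by_contra! hx
    exact hα_ne x (ContinuousLinearMap.ext hx)
  obtain ⟨v, hv⟩ := Classical.skolem.1 hv
  set P : L → ℝ → ℝ := fun x t => lift ζ (x, t) (v x, 0) / α x (v x) with hP
  set Q : L → ℝ → ℝ := fun x t => lift ζ (x, t) (0, 1) with hQ
  have hlift : ∀ x t (u : E) s, lift ζ (x, t) (u, s) = P x t * α x u + Q x t * s := by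
    intro x t u s
    -- Splitting `u` into its component along `v x` and a remainder tangent to the leaf, on which
    -- the lift vanishes.
    have h1 : α x (u - (α x u / α x (v x)) • v x) = 0 := by
      have h0 : α x (u - (α x u / α x (v x)) • v x) = α x u - (α x u / α x (v x)) • α x (v x) :=
        ((α x).map_sub _ _).trans (congrArg _ ((α x).map_smul _ _))
      rw [h0, smul_eq_mul, div_mul_cancel₀ _ (hv x), sub_self]
    have h2 := h x t _ h1
    have h3 : ((u, s) : E × ℝ) = (u - (α x u / α x (v x)) • v x, 0) +
        ((α x u / α x (v x)) • (v x, 0) + s • (0, 1)) := by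
      ext <;> simp
    rw [h3, map_add, map_add, h2, map_smul, map_smul, hP, hQ]
    simp only [smul_eq_mul]
    ring
  refine ⟨P, Q, fun x t => ?_, fun x t => ?_, hlift⟩
  all_goals
    have hx := mem_extChartAt_target (I := 𝓘(ℝ, E)) x
    have hW : ContDiffAt ℝ ∞ (ζ.onSpace (param φ x)) (extChartAt 𝓘(ℝ, E) x x, t) :=
      hζ.contDiffAt_pullback (contMDiffAt_param x hx)
    have htarget : ∀ᶠ y : E × ℝ in 𝓝 (extChartAt 𝓘(ℝ, E) x x, t),
        y.1 ∈ (extChartAt 𝓘(ℝ, E) x).target :=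
      continuousAt_fst.eventually_mem (extChartAt_target_mem_nhds (I := 𝓘(ℝ, E)) x)
  · have ha : ContDiffAt ℝ ∞ (fun y : E × ℝ => α.onSpace (extChartAt 𝓘(ℝ, E) x).symm y.1 (v x))
        (extChartAt 𝓘(ℝ, E) x x, t) :=
      ((hα.contDiffAt_pullback (contMDiffAt_extChartAt_symm_of_mem hx)).comp
        (extChartAt 𝓘(ℝ, E) x x, t) contDiffAt_fst).clm_apply contDiffAt_const
    have ha0 : α.onSpace (extChartAt 𝓘(ℝ, E) x).symm (extChartAt 𝓘(ℝ, E) x x) (v x) ≠ 0 :=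
      (α.onSpace_chart_self x (v x)).trans_ne (hv x)
    have hWv : ContDiffAt ℝ ∞ (fun y : E × ℝ => ζ.onSpace (param φ x) y (v x, 0))
        (extChartAt 𝓘(ℝ, E) x x, t) := hW.clm_apply contDiffAt_const
    refine (hWv.div ha ha0).congr_of_eventuallyEq ?_
    filter_upwards [htarget, ha.continuousAt.eventually_ne ha0] with y hy hy0
    rw [Pi.div_apply, onSpace_param_eq hlift x hy, eq_div_iff hy0, mul_zero, add_zero]
  · have hWv : ContDiffAt ℝ ∞ (fun y : E × ℝ => ζ.onSpace (param φ x) y (0, 1))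
        (extChartAt 𝓘(ℝ, E) x x, t) := hW.clm_apply contDiffAt_const
    refine hWv.congr_of_eventuallyEq ?_
    filter_upwards [htarget] with y hy
    rw [onSpace_param_eq hlift x hy, map_zero, mul_zero, zero_add, mul_one]

/-- The value of `P α + Q dt` at the base point of a chart. -/
theorem HasCoefficients.onSpace_param_self (h : HasCoefficients ζ α P Q) (x : L) (t : ℝ) (u : E)
    (s : ℝ) : ζ.onSpace (param φ x) (extChartAt 𝓘(ℝ, E) x x, t) (u, s) =
      P x t * α x u + Q x t * s := by
  rw [onSpace_param_eq h.lift_eq x (mem_extChartAt_target x), α.onSpace_chart_self]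
  simp only [extChartAt_to_inv]

/-- The exterior derivative of `P α + Q dt`, for closed `α`. -/
theorem HasCoefficients.extDeriv_eq (h : HasCoefficients ζ α P Q) (hα : α.IsSmooth)
    (hα_closed : ∀ x u v, α.extDeriv x u v = 0) (hζ : ζ.IsSmooth) (x : L) (t : ℝ) (w w' : E × ℝ) :
    ζ.extDeriv (param φ x (extChartAt 𝓘(ℝ, E) x x, t))
      (mfderiv 𝓘(ℝ, E × ℝ) (𝓘(ℝ, E).prod 𝓘(ℝ, ℝ)) (param φ x) (extChartAt 𝓘(ℝ, E) x x, t) w)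
      (mfderiv 𝓘(ℝ, E × ℝ) (𝓘(ℝ, E).prod 𝓘(ℝ, ℝ)) (param φ x) (extChartAt 𝓘(ℝ, E) x x, t) w') =
    fderiv ℝ (fun y : E × ℝ => P ((extChartAt 𝓘(ℝ, E) x).symm y.1) y.2)
        (extChartAt 𝓘(ℝ, E) x x, t) w * α x w'.1 -
      fderiv ℝ (fun y : E × ℝ => P ((extChartAt 𝓘(ℝ, E) x).symm y.1) y.2)
        (extChartAt 𝓘(ℝ, E) x x, t) w' * α x w.1 +
      (fderiv ℝ (fun y : E × ℝ => Q ((extChartAt 𝓘(ℝ, E) x).symm y.1) y.2)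
        (extChartAt 𝓘(ℝ, E) x x, t) w * w'.2 -
      fderiv ℝ (fun y : E × ℝ => Q ((extChartAt 𝓘(ℝ, E) x).symm y.1) y.2)
        (extChartAt 𝓘(ℝ, E) x x, t) w' * w.2) := by
  have hx := mem_extChartAt_target (I := 𝓘(ℝ, E)) x
  have hψ := contMDiffAt_param (φ := φ) x (y := (extChartAt 𝓘(ℝ, E) x x, t)) hx
  rw [← hζ.fderiv_pullback_sub hψ]
  have hW : DifferentiableAt ℝ (ζ.onSpace (param φ x)) (extChartAt 𝓘(ℝ, E) x x, t) :=
    (hζ.contDiffAt_pullback hψ).differentiableAt (by simp)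
  have ha : DifferentiableAt ℝ (α.onSpace (extChartAt 𝓘(ℝ, E) x).symm) (extChartAt 𝓘(ℝ, E) x x) :=
    (hα.contDiffAt_pullback (contMDiffAt_extChartAt_symm_of_mem hx)).differentiableAt (by simp)
  -- Closedness of α makes the derivative of its local expression symmetric, so the P dα term drops
  -- out.
  have hsymm : ∀ u v : E,
      fderiv ℝ (α.onSpace (extChartAt 𝓘(ℝ, E) x).symm) (extChartAt 𝓘(ℝ, E) x x) u v =
      fderiv ℝ (α.onSpace (extChartAt 𝓘(ℝ, E) x).symm) (extChartAt 𝓘(ℝ, E) x x) v u := fun u v => by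
    have h1 := hα.fderiv_pullback_sub (contMDiffAt_extChartAt_symm_of_mem hx) u v
    rw [hα_closed] at h1
    exact sub_eq_zero.1 h1
  have htarget : ∀ᶠ y : E × ℝ in 𝓝 (extChartAt 𝓘(ℝ, E) x x, t),
      y.1 ∈ (extChartAt 𝓘(ℝ, E) x).target :=
    continuousAt_fst.eventually_mem (extChartAt_target_mem_nhds (I := 𝓘(ℝ, E)) x)
  have hP := ((h.left x t).differentiableAt (by simp)).hasFDerivAt
  have hQ := ((h.right x t).differentiableAt (by simp)).hasFDerivAt
  -- the derivative in the direction `v` of the coordinate expression, evaluated at `v'`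
  have key : ∀ v v' : E × ℝ, fderiv ℝ (ζ.onSpace (param φ x)) (extChartAt 𝓘(ℝ, E) x x, t) v v' =
      P x t * fderiv ℝ (α.onSpace (extChartAt 𝓘(ℝ, E) x).symm) (extChartAt 𝓘(ℝ, E) x x) v.1 v'.1 +
      fderiv ℝ (fun y : E × ℝ => P ((extChartAt 𝓘(ℝ, E) x).symm y.1) y.2)
        (extChartAt 𝓘(ℝ, E) x x, t) v * α x v'.1 +
      fderiv ℝ (fun y : E × ℝ => Q ((extChartAt 𝓘(ℝ, E) x).symm y.1) y.2)
        (extChartAt 𝓘(ℝ, E) x x, t) v * v'.2 := by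
    intro v v'
    have h1 := hW.hasFDerivAt.clm_apply (hasFDerivAt_const v' _)
    have h2 := (HasFDerivAt.comp (f := (Prod.fst : E × ℝ → E))
      (extChartAt 𝓘(ℝ, E) x x, t) ha.hasFDerivAt hasFDerivAt_fst).clm_apply
      (hasFDerivAt_const v'.1 _)
    have h3 := (hP.mul h2).add (hQ.mul_const v'.2)
    have h4 := h3.congr_of_eventuallyEq (f₁ := fun y => ζ.onSpace (param φ x) y v')
      (by
        filter_upwards [htarget] with y hy
        exact onSpace_param_eq h.lift_eq x hy v'.1 v'.2)
    have h5 := congrArg (fun l => l v) (h1.unique h4)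
    have h6 := α.onSpace_chart_self x v'.1
    simp at h5 h6 ⊢
    rw [h5, h6]
    ring
  rw [key, key, hsymm w.1]
  ring

end MappingTorus

/-! ### Exact constant multiples of α vanish. -/

section MultipleOfForm

variable {E L : Type*} [NormedAddCommGroup E] [NormedSpace ℝ E]
  [TopologicalSpace L] [ChartedSpace E L] [IsManifold 𝓘(ℝ, E) ∞ L]

/-- On a compact manifold, no nonzero constant multiple of a nowhere-vanishing one-form is exact. -/
theorem eq_zero_of_differential_eq_const_mul [CompactSpace L] [Nonempty L]
    {α : OneForm 𝓘(ℝ, E) L} (hα_ne : ∀ x, α x ≠ 0) {h : L → ℝ}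
    (hh : ContMDiff 𝓘(ℝ, E) 𝓘(ℝ, ℝ) ∞ h) {k : ℝ}
    (hk : ∀ x u, OneForm.differential 𝓘(ℝ, E) h x u = k * α x u) : k = 0 := by
  -- At a maximum of `h` the differential is zero while α is not, so the factor `k` must vanish.
  obtain ⟨x, -, hx⟩ := isCompact_univ.exists_isMaxOn univ_nonempty hh.continuous.continuousOn
  have hmax : IsLocalMax (h ∘ (extChartAt 𝓘(ℝ, E) x).symm) (extChartAt 𝓘(ℝ, E) x x) :=
    Filter.Eventually.of_forall fun y => by
      simp only [Function.comp_apply, extChartAt_to_inv]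
      exact hx (mem_univ _)
  have h1 := hmax.hasFDerivAt_eq_zero
    (hasFDerivAt_comp_chart (mem_extChartAt_target x) (hh.mdifferentiable (by simp)))
  by_contra hk0
  refine hα_ne x (ContinuousLinearMap.ext fun (u : E) => ?_)
  have h2 : k * α x u = 0 := by
    refine (hk x u).symm.trans ?_
    exact (OneForm.onSpace_chart_self _ x u).symm.trans (congrArg (fun l => l u) h1)
  exact (mul_eq_zero.1 h2).resolve_left hk0

/-- A smooth function on a compact connected manifold whose differential is a constant multiple of a
nowhere-vanishing one-form is constant. -/
theorem eq_of_differential_eq_const_mul [CompactSpace L] [ConnectedSpace L]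
    {α : OneForm 𝓘(ℝ, E) L} (hα : α.IsSmooth) (hα_ne : ∀ x, α x ≠ 0) {h : L → ℝ}
    (hh : ContMDiff 𝓘(ℝ, E) 𝓘(ℝ, ℝ) ∞ h) {k : ℝ}
    (hk : ∀ x u, OneForm.differential 𝓘(ℝ, E) h x u = k * α x u) (x y : L) : h x = h y := by
  have hk0 := eq_zero_of_differential_eq_const_mul hα_ne hh hk
  obtain ⟨C, hC⟩ := exists_oscillation_bound_of_differential hα
  have h1 := hC h 0 (hh.mdifferentiable (by simp)) le_rfl (fun x u => by simp [hk, hk0]) x y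
  rw [mul_zero] at h1
  exact sub_eq_zero.1 (abs_eq_zero.1 (le_antisymm h1 (abs_nonneg _)))

end MultipleOfForm

/-! ### Equivariance of the coefficients and the structure equations. -/

namespace MappingTorus

variable {E L : Type*} [NormedAddCommGroup E] [NormedSpace ℝ E]
  [TopologicalSpace L] [ChartedSpace E L] [T2Space L]

section Coefficients

variable [LocallyCompactSpace L] {φ : L ≃ₘ⟮𝓘(ℝ, E), 𝓘(ℝ, E)⟯ L}
  {ζ : OneForm (𝓘(ℝ, E).prod 𝓘(ℝ, ℝ)) (MappingTorus φ)} {α : OneForm 𝓘(ℝ, E) L}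
  {P Q : L → ℝ → ℝ}

theorem HasCoefficients.right_add_one (h : HasCoefficients ζ α P Q) (x : L) (t : ℝ) :
    Q (φ x) (t + 1) = Q x t := by
  have h1 : P (φ x) (t + 1) * (OneForm.pullback (J := 𝓘(ℝ, E)) φ α x : E →L[ℝ] ℝ) 0 +
      Q (φ x) (t + 1) * 1 = P x t * (α x : E →L[ℝ] ℝ) 0 + Q x t * 1 :=
    ((h.lift_eq _ _ _ _).symm.trans (lift_apply_add_one ζ x t 0 1)).trans (h.lift_eq _ _ _ _)
  rw [map_zero, map_zero] at h1
  simpa using h1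

theorem HasCoefficients.left_add_one (h : HasCoefficients ζ α P Q) (hα_ne : ∀ x, α x ≠ 0) {lam : ℝ}
    (hφα : OneForm.pullback (J := 𝓘(ℝ, E)) φ α = fun x => Real.exp lam • α x) (x : L) (t : ℝ) :
    P (φ x) (t + 1) * Real.exp lam = P x t := by
  obtain ⟨u, hu⟩ : ∃ u : E, α x u ≠ 0 := by
    by_contra! hx
    exact hα_ne x (ContinuousLinearMap.ext hx)
  have h1 : P (φ x) (t + 1) * OneForm.pullback (J := 𝓘(ℝ, E)) φ α x u + Q (φ x) (t + 1) * 0 =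
      P x t * α x u + Q x t * 0 :=
    ((h.lift_eq _ _ _ _).symm.trans (lift_apply_add_one ζ x t u 0)).trans (h.lift_eq _ _ _ _)
  have h2 : OneForm.pullback (J := 𝓘(ℝ, E)) φ α x u = Real.exp lam * α x u :=
    congrArg (fun β : OneForm 𝓘(ℝ, E) L => β x u) hφα
  have h3 : P (φ x) (t + 1) * (Real.exp lam * α x u) = P x t * α x u := by
    linear_combination h1 - P (φ x) (t + 1) * h2
  rw [← mul_assoc] at h3
  exact mul_right_cancel₀ hu h3

/-- The components of `d (P α + Q dt)` for closed `α`. -/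
theorem HasCoefficients.structure_equations [IsManifold 𝓘(ℝ, E) ∞ L]
    (h : HasCoefficients ζ α P Q) (hα : α.IsSmooth)
    (hα_closed : ∀ x u v, α.extDeriv x u v = 0) (hζ : ζ.IsSmooth)
    {η : OneForm (𝓘(ℝ, E).prod 𝓘(ℝ, ℝ)) (MappingTorus φ)} {P' Q' : L → ℝ → ℝ}
    (h' : HasCoefficients η α P' Q')
    (hd : ∀ p u v, ζ.extDeriv p u v = OneForm.wedge η ζ p u v) (x : L) (t : ℝ) :
    (∀ u u', OneForm.differential 𝓘(ℝ, E) (fun x => P x t) x u * α x u' =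
      OneForm.differential 𝓘(ℝ, E) (fun x => P x t) x u' * α x u) ∧
    ∀ u, OneForm.differential 𝓘(ℝ, E) (fun x => Q x t) x u =
      (deriv (P x) t + P' x t * Q x t - Q' x t * P x t) * α x u := by
  have key : ∀ w w' : E × ℝ, _ := fun w w' =>
    (h.extDeriv_eq hα hα_closed hζ x t w w').symm.trans (hd _ _ _)
  have hwedge : ∀ w w' : E × ℝ, OneForm.wedge η ζ (param φ x (extChartAt 𝓘(ℝ, E) x x, t))
      (mfderiv 𝓘(ℝ, E × ℝ) (𝓘(ℝ, E).prod 𝓘(ℝ, ℝ)) (param φ x) (extChartAt 𝓘(ℝ, E) x x, t) w)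
      (mfderiv 𝓘(ℝ, E × ℝ) (𝓘(ℝ, E).prod 𝓘(ℝ, ℝ)) (param φ x) (extChartAt 𝓘(ℝ, E) x x, t) w') =
      (P' x t * α x w.1 + Q' x t * w.2) * (P x t * α x w'.1 + Q x t * w'.2) -
      (P' x t * α x w'.1 + Q' x t * w'.2) * (P x t * α x w.1 + Q x t * w.2) := fun w w' => by
    rw [← h.onSpace_param_self, ← h.onSpace_param_self, ← h'.onSpace_param_self,
      ← h'.onSpace_param_self]
    rfl
  -- Pairs of directions along L isolate the dP ∧ α term; one direction along L paired with ∂/∂t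
  -- isolates the mixed component.
  constructor
  · intro (u : E) (u' : E)
    have h1 := (key (u, 0) (u', 0)).trans (hwedge _ _)
    rw [h.left.fderiv_apply_left, h.left.fderiv_apply_left] at h1
    linear_combination h1
  · intro (u : E)
    have h1 := (key (u, 0) (0, 1)).trans (hwedge _ _)
    have h0 : α x (0 : E) = 0 := (α x).map_zero
    rw [h.left.fderiv_apply_left, h.left.fderiv_apply_right, h.right.fderiv_apply_left] at h1
    linear_combination h1 - OneForm.differential 𝓘(ℝ, E) (fun x => P x t) x u * h0

/-- For u in ker α, the vector (u, 0) is annihilated by the lifts of both model forms, so its image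
is tangent to the foliation. -/
theorem lift_eq_zero_of_mem_ker {lam : ℝ}
    (hφα : OneForm.pullback (J := 𝓘(ℝ, E)) φ α = fun x => Real.exp lam • α x)
    (hker : ∀ p, modelFoliation φ α lam p ≤ LinearMap.ker (ζ p).toLinearMap)
    (x : L) (t : ℝ) (u : E) (hu : α x u = 0) : lift ζ (x, t) (u, 0) = 0 := by
  refine hker (mk φ (x, t)) (x := mfderiv (𝓘(ℝ, E).prod 𝓘(ℝ, ℝ)) (𝓘(ℝ, E).prod 𝓘(ℝ, ℝ)) (mk φ)
    (x, t) ((u, 0) : E × ℝ)) ⟨?_, ?_⟩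
  · refine (congrArg (fun β => β (x, t) ((u, 0) : E × ℝ))
      (pullback_modelForm₁ φ α lam hφα)).trans ?_
    have h1 : OneForm.pullback (J := 𝓘(ℝ, E).prod 𝓘(ℝ, ℝ)) Prod.fst α (x, t) ((u, 0) : E × ℝ) =
        α x u := by
      change α x (mfderiv (𝓘(ℝ, E).prod 𝓘(ℝ, ℝ)) 𝓘(ℝ, E) Prod.fst (x, t) ((u, 0) : E × ℝ)) = _
      rw [mfderiv_fst]
      rfl
    change _ * OneForm.pullback (J := 𝓘(ℝ, E).prod 𝓘(ℝ, ℝ)) Prod.fst α (x, t) ((u, 0) : E × ℝ) = 0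
    rw [h1, hu, mul_zero]
  · refine (congrArg (fun β => β (x, t) ((u, 0) : E × ℝ)) (pullback_modelForm₂ φ lam)).trans ?_
    have h1 : OneForm.differential (𝓘(ℝ, E).prod 𝓘(ℝ, ℝ)) (Prod.snd : L × ℝ → ℝ) (x, t)
        ((u, 0) : E × ℝ) = 0 := by
      rw [OneForm.differential, mfderiv_snd]
      rfl
    exact (congrArg (-lam * ·) h1).trans (mul_zero _)

end Coefficients

/-! ### Reduction of the coefficients to functions of t. -/

section NormalForm

variable [IsManifold 𝓘(ℝ, E) ∞ L] [CompactSpace L] [ConnectedSpace L]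
  {φ : L ≃ₘ⟮𝓘(ℝ, E), 𝓘(ℝ, E)⟯ L} {α : OneForm 𝓘(ℝ, E) L} {lam : ℝ}
  {ζ₁ ζ₂ : OneForm (𝓘(ℝ, E).prod 𝓘(ℝ, ℝ)) (MappingTorus φ)}

/-- A closed form `C α + D dt` on the mapping torus has `C = 0`, and `D` depends on `t` only. -/
theorem HasCoefficients.of_closed (hα : α.IsSmooth)
    (hα_closed : ∀ x u v, α.extDeriv x u v = 0) (hα_ne : ∀ x, α x ≠ 0) (hlam : lam ≠ 0)
    (hφα : OneForm.pullback (J := 𝓘(ℝ, E)) φ α = fun x => Real.exp lam • α x)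
    (hζ₂ : ζ₂.IsSmooth) (hd : ∀ p u v, ζ₂.extDeriv p u v = 0)
    {C D : L → ℝ → ℝ} (h : HasCoefficients ζ₂ α C D) :
    (∀ x t, C x t = 0) ∧ ∀ t x y, D x t = D y t := by
  -- Since ζ₂ ∧ ζ₂ = 0, closedness is an instance of the structure equation used for ζ₁.
  have hself : ∀ p u v, ζ₂.extDeriv p u v = OneForm.wedge ζ₂ ζ₂ p u v := fun p u v => by
    rw [hd, OneForm.wedge]
    ring
  have hs := h.structure_equations hα hα_closed hζ₂ h hself
  have hC : ∀ t x y, C x t = C y t := fun t =>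
    eq_of_basic φ hα hα_ne hlam hφα (h.left.contMDiff t) fun x => (hs x t).1
  obtain ⟨x₀⟩ := (inferInstance : Nonempty L)
  have hCx : ∀ x, C x = C x₀ := fun x => funext fun t => hC t x x₀
  have hD' : ∀ t x u, OneForm.differential 𝓘(ℝ, E) (fun x => D x t) x u =
      deriv (C x₀) t * α x u := fun t x u => by
    rw [(hs x t).2 u, hCx x]
    ring
  have hC' : ∀ t, deriv (C x₀) t = 0 := fun t =>
    eq_zero_of_differential_eq_const_mul hα_ne (h.right.contMDiff t) (hD' t)
  refine ⟨fun x t => ?_, fun t =>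
    eq_of_differential_eq_const_mul hα hα_ne (h.right.contMDiff t) (hD' t)⟩
  -- C is constant in t as well, while the deck transformation scales it by e^λ ≠ 1; hence C = 0.
  have h1 : C x₀ (t + 1) = C x₀ t :=
    is_const_of_deriv_eq_zero ((h.left.contDiff x₀).differentiable (by simp)) hC' _ _
  have h2 := h.left_add_one hα_ne hφα x t
  rw [hCx (φ x), hCx x, h1] at h2
  rw [hCx]
  have h3 : C x₀ t * (Real.exp lam - 1) = 0 := by linear_combination h2
  refine (mul_eq_zero.1 h3).resolve_right ?_
  rw [sub_eq_zero, Real.exp_eq_one_iff]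
  exact hlam

/-- If `d (A α + B dt) = (D dt) ∧ (A α + B dt)`, where `D` depends on `t` only, then `A` and `B`
depend on `t` only and `A' = D A`. -/
theorem HasCoefficients.of_structure_equation (hα : α.IsSmooth)
    (hα_closed : ∀ x u v, α.extDeriv x u v = 0) (hα_ne : ∀ x, α x ≠ 0) (hlam : lam ≠ 0)
    (hφα : OneForm.pullback (J := 𝓘(ℝ, E)) φ α = fun x => Real.exp lam • α x)
    (hζ₁ : ζ₁.IsSmooth) (hd : ∀ p u v, ζ₁.extDeriv p u v = OneForm.wedge ζ₂ ζ₁ p u v)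
    {A B C D : L → ℝ → ℝ} (h : HasCoefficients ζ₁ α A B) (h' : HasCoefficients ζ₂ α C D)
    (hC : ∀ x t, C x t = 0) (hD : ∀ t x y, D x t = D y t) :
    (∀ t x y, A x t = A y t) ∧ (∀ t x y, B x t = B y t) ∧
      ∀ x t, deriv (A x) t = D x t * A x t := by
  have hs := h.structure_equations hα hα_closed hζ₁ h' hd
  have hA : ∀ t x y, A x t = A y t := fun t =>
    eq_of_basic φ hα hα_ne hlam hφα (h.left.contMDiff t) fun x => (hs x t).1
  have hB' : ∀ t x₀ x u, OneForm.differential 𝓘(ℝ, E) (fun x => B x t) x u =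
      (deriv (A x₀) t - D x₀ t * A x₀ t) * α x u := fun t x₀ x u => by
    have hAx : A x = A x₀ := funext fun t => hA t x x₀
    rw [(hs x t).2 u, hAx, hC, hD t x x₀]
    ring
  obtain ⟨x₀⟩ := (inferInstance : Nonempty L)
  exact ⟨hA, fun t =>
    eq_of_differential_eq_const_mul hα hα_ne (h.right.contMDiff t) (hB' t x₀), fun x t =>
    sub_eq_zero.1 (eq_zero_of_differential_eq_const_mul hα_ne (h.right.contMDiff t) (hB' t x))⟩

end NormalForm

/-! ### Evaluating the forms of the normal form at representatives. -/

section Descent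

variable [LocallyCompactSpace L] (φ : L ≃ₘ⟮𝓘(ℝ, E), 𝓘(ℝ, E)⟯ L)

/-- The differential of a function of `t`. -/
theorem differential_comp_toCircle_apply {f : Circle → ℝ} {F : ℝ → ℝ} (hF : Differentiable ℝ F)
    (hf : ∀ t, f (Circle.exp (2 * Real.pi * t)) = F t) (p : MappingTorus φ) (u : E) (s : ℝ) :
    OneForm.differential (𝓘(ℝ, E).prod 𝓘(ℝ, ℝ)) (f ∘ toCircle φ) p ((u, s) : E × ℝ) =
      deriv F (rep φ p).2 * s := by
  have h1 : HasMFDerivAt (𝓘(ℝ, E).prod 𝓘(ℝ, ℝ)) 𝓘(ℝ, ℝ) (F ∘ (Prod.snd : L × ℝ → ℝ)) (rep φ p) _ :=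
    HasMFDerivAt.comp (rep φ p) (hF (rep φ p).2).hasFDerivAt.hasMFDerivAt
      (hasMFDerivAt_snd (I := 𝓘(ℝ, E)) (I' := 𝓘(ℝ, ℝ)) (rep φ p))
  have h2 : (f ∘ toCircle φ) ∘ mk φ = F ∘ (Prod.snd : L × ℝ → ℝ) := funext fun q => hf q.2
  rw [← h2] at h1
  have h3 := (hasMFDerivAt_of_comp_localHomeomorph (𝓘(ℝ, E).prod 𝓘(ℝ, ℝ)) (isLocalHomeomorph_mk φ)
    (rightInverse_rep φ) p h1).mfderiv
  refine (congrArg (fun l : E × ℝ →L[ℝ] ℝ => l (u, s)) h3).trans ?_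
  change fderiv ℝ F (rep φ p).2 s = _
  rw [fderiv_eq_smul_deriv, smul_eq_mul, mul_comm]

theorem modelForm₁_apply {α : OneForm 𝓘(ℝ, E) L} {lam : ℝ}
    (hφα : OneForm.pullback (J := 𝓘(ℝ, E)) φ α = fun x => Real.exp lam • α x)
    (p : MappingTorus φ) (u : E) (s : ℝ) :
    modelForm₁ φ α lam p ((u, s) : E × ℝ) =
      Real.exp (-lam * (rep φ p).2) * α (rep φ p).1 u := by
  refine (lift_rep _ p (u, s)).symm.trans ?_
  refine (congrArg (fun β => β (rep φ p) ((u, s) : E × ℝ))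
    (pullback_modelForm₁ φ α lam hφα)).trans ?_
  have h1 : OneForm.pullback (J := 𝓘(ℝ, E).prod 𝓘(ℝ, ℝ)) Prod.fst α (rep φ p) ((u, s) : E × ℝ) =
      α (rep φ p).1 u := by
    change α (rep φ p).1 (mfderiv (𝓘(ℝ, E).prod 𝓘(ℝ, ℝ)) 𝓘(ℝ, E) Prod.fst (rep φ p)
      ((u, s) : E × ℝ)) = _
    rw [mfderiv_fst]
    rfl
  exact congrArg (Real.exp (-lam * (rep φ p).2) * ·) h1

theorem modelForm₂_apply (lam : ℝ) (p : MappingTorus φ) (u : E) (s : ℝ) :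
    modelForm₂ φ lam p ((u, s) : E × ℝ) = -lam * s := by
  refine (lift_rep _ p (u, s)).symm.trans ?_
  refine (congrArg (fun β => β (rep φ p) ((u, s) : E × ℝ)) (pullback_modelForm₂ φ lam)).trans ?_
  have h1 : OneForm.differential (𝓘(ℝ, E).prod 𝓘(ℝ, ℝ)) (Prod.snd : L × ℝ → ℝ) (rep φ p)
      ((u, s) : E × ℝ) = s := by
    rw [OneForm.differential, mfderiv_snd]
    rfl
  exact congrArg (-lam * ·) h1

end Descent

end MappingTorus

/-! ### Assembly of the normal form. -/

theorem mainTheorem8 {E L : Type*} [NormedAddCommGroup E] [NormedSpace ℝ E] [FiniteDimensional ℝ E]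
    [TopologicalSpace L] [ChartedSpace E L] [IsManifold 𝓘(ℝ, E) ∞ L]
    [T2Space L] [CompactSpace L] [ConnectedSpace L]
    (φ : L ≃ₘ⟮𝓘(ℝ, E), 𝓘(ℝ, E)⟯ L)
    (α : OneForm 𝓘(ℝ, E) L) (hα : α.IsSmooth)
    (hα_closed : ∀ x u v, α.extDeriv x u v = 0)
    (hα_ne : ∀ x, α x ≠ 0)
    (lam : ℝ) (hlam : lam ≠ 0)
    (hφα : OneForm.pullback (J := 𝓘(ℝ, E)) φ α = fun x => Real.exp lam • α x)
    (ζ₁ ζ₂ : OneForm (𝓘(ℝ, E).prod 𝓘(ℝ, ℝ)) (MappingTorus φ))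
    (hζ₁ : ζ₁.IsSmooth) (hζ₂ : ζ₂.IsSmooth)
    (hindep : ∀ p, LinearIndependent ℝ ![ζ₁ p, ζ₂ p])
    (hker : ∀ p, MappingTorus.modelFoliation φ α lam p =
      LinearMap.ker (ζ₁ p).toLinearMap ⊓ LinearMap.ker (ζ₂ p).toLinearMap)
    (hMC₁ : ∀ p u v, ζ₁.extDeriv p u v - OneForm.wedge ζ₂ ζ₁ p u v = 0)
    (hMC₂ : ∀ p u v, ζ₂.extDeriv p u v = 0) :
    ∃ (f g : C^∞⟮𝓡 1, Circle; 𝓘(ℝ, ℝ), ℝ⟯) (K : ℝ), K ≠ 0 ∧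
      (∀ p, ζ₂ p = MappingTorus.modelForm₂ φ lam p +
        OneForm.differential _ (f ∘ MappingTorus.toCircle φ) p) ∧
      (∀ p, ζ₁ p = Real.exp (f (MappingTorus.toCircle φ p)) •
        (K • MappingTorus.modelForm₁ φ α lam p +
          OneForm.differential _ (g ∘ MappingTorus.toCircle φ) p -
          g (MappingTorus.toCircle φ p) • MappingTorus.modelForm₂ φ lam p)) := by
  have hMC₁' : ∀ p u v, ζ₁.extDeriv p u v = OneForm.wedge ζ₂ ζ₁ p u v := fun p u v =>
    sub_eq_zero.1 (hMC₁ p u v)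
  obtain ⟨A, B, hAB⟩ := MappingTorus.exists_hasCoefficients hα hα_ne hζ₁
    (MappingTorus.lift_eq_zero_of_mem_ker hφα fun p => (hker p).le.trans inf_le_left)
  obtain ⟨C, D, hCD⟩ := MappingTorus.exists_hasCoefficients hα hα_ne hζ₂
    (MappingTorus.lift_eq_zero_of_mem_ker hφα fun p => (hker p).le.trans inf_le_right)
  obtain ⟨hC, hD⟩ := hCD.of_closed hα hα_closed hα_ne hlam hφα hζ₂ hMC₂
  obtain ⟨hA, hB, hA'⟩ :=
    hAB.of_structure_equation hα hα_closed hα_ne hlam hφα hζ₁ hMC₁' hCD hC hD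
  obtain ⟨x₀⟩ := (inferInstance : Nonempty L)
  have hζ₁_apply : ∀ p (u : E) (s : ℝ), ζ₁ p ((u, s) : E × ℝ) =
      A x₀ (MappingTorus.rep φ p).2 * α (MappingTorus.rep φ p).1 u +
        B x₀ (MappingTorus.rep φ p).2 * s := fun p u s => by
    rw [hA _ x₀ (MappingTorus.rep φ p).1, hB _ x₀ (MappingTorus.rep φ p).1]
    exact (MappingTorus.lift_rep ζ₁ p (u, s)).symm.trans (hAB.lift_eq _ _ u s)
  have hζ₂_apply : ∀ p (u : E) (s : ℝ), ζ₂ p ((u, s) : E × ℝ) =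
      D x₀ (MappingTorus.rep φ p).2 * s := fun p u s => by
    rw [hD _ x₀ (MappingTorus.rep φ p).1]
    refine (MappingTorus.lift_rep ζ₂ p (u, s)).symm.trans ((hCD.lift_eq (MappingTorus.rep φ p).1
      (MappingTorus.rep φ p).2 u s).trans ?_)
    rw [hC, zero_mul, zero_add]
  -- If A vanished here, both forms would be multiples of dt, and D ζ₁ - B ζ₂ = 0. Independence
  -- gives B = 0, so ζ₁ = 0 at this point, which contradicts independence again.
  have hA0 : A x₀ (MappingTorus.rep φ (MappingTorus.mk φ (x₀, 0))).2 ≠ 0 := fun h0 => by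
    set p := MappingTorus.mk φ (x₀, 0)
    have hpair := LinearIndependent.pair_iff.1 (hindep p)
    have h1 : D x₀ (MappingTorus.rep φ p).2 • ζ₁ p +
        (-B x₀ (MappingTorus.rep φ p).2) • ζ₂ p = 0 := by
      refine ContinuousLinearMap.ext fun (v : E × ℝ) => ?_
      change D x₀ (MappingTorus.rep φ p).2 * ζ₁ p ((v.1, v.2) : E × ℝ) +
        (-B x₀ (MappingTorus.rep φ p).2) * ζ₂ p ((v.1, v.2) : E × ℝ) = 0
      rw [hζ₁_apply, hζ₂_apply, h0]
      ring
    obtain ⟨-, h2⟩ := hpair _ _ h1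
    have h3 : (1 : ℝ) • ζ₁ p + (0 : ℝ) • ζ₂ p = 0 := by
      refine ContinuousLinearMap.ext fun (v : E × ℝ) => ?_
      change 1 * ζ₁ p ((v.1, v.2) : E × ℝ) + 0 * ζ₂ p ((v.1, v.2) : E × ℝ) = 0
      rw [hζ₁_apply, h0, neg_eq_zero.1 h2]
      ring
    exact one_ne_zero (hpair _ _ h3).1
  obtain ⟨F, G, K, hF, hG, hF1, hG1, hK, hDF, hAF, hBF⟩ := exists_periodic_normal_form hlam
    (hAB.right.contDiff x₀) (hCD.right.contDiff x₀)
    (fun t => hA' x₀ t ▸ ((hAB.left.contDiff x₀).differentiable (by simp) t).hasDerivAt)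
    (fun t => by rw [← hAB.left_add_one hα_ne hφα x₀ t, hA _ (φ x₀) x₀])
    (fun t => by rw [← hAB.right_add_one x₀ t, hB _ (φ x₀) x₀]) hA0
  obtain ⟨f, hf⟩ := exists_contMDiffMap_circle hF hF1
  obtain ⟨g, hg⟩ := exists_contMDiffMap_circle hG hG1
  have hcircle : ∀ p : MappingTorus φ, MappingTorus.toCircle φ p =
      Circle.exp (2 * Real.pi * (MappingTorus.rep φ p).2) := fun p => by
    rw [← MappingTorus.toCircle_mk φ, MappingTorus.rightInverse_rep]
  refine ⟨f, g, K, hK, fun p => ContinuousLinearMap.ext fun (v : E × ℝ) => ?_,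
    fun p => ContinuousLinearMap.ext fun (v : E × ℝ) => ?_⟩
  · change ζ₂ p ((v.1, v.2) : E × ℝ) = MappingTorus.modelForm₂ φ lam p ((v.1, v.2) : E × ℝ) +
      OneForm.differential _ (f ∘ MappingTorus.toCircle φ) p ((v.1, v.2) : E × ℝ)
    rw [hζ₂_apply, MappingTorus.modelForm₂_apply,
      MappingTorus.differential_comp_toCircle_apply φ (hF.differentiable (by simp)) hf, hDF]
    ring
  · change ζ₁ p ((v.1, v.2) : E × ℝ) = Real.exp (f (MappingTorus.toCircle φ p)) *
      (K * MappingTorus.modelForm₁ φ α lam p ((v.1, v.2) : E × ℝ) +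
        OneForm.differential _ (g ∘ MappingTorus.toCircle φ) p ((v.1, v.2) : E × ℝ) -
        g (MappingTorus.toCircle φ p) * MappingTorus.modelForm₂ φ lam p ((v.1, v.2) : E × ℝ))
    rw [hζ₁_apply, MappingTorus.modelForm₁_apply φ hφα, MappingTorus.modelForm₂_apply,
      MappingTorus.differential_comp_toCircle_apply φ (hG.differentiable (by simp)) hg, hcircle, hf,
      hg, hAF, hBF]
    ring
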